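/- **Model.** Let $\mathbb{L}^2=(\mathbb{Z}^2,\mathbb{E})$ be the square lattice with nearest-neighbour edges, and let each horizontal edge be open with probability $p_h$ and each vertical edge with probability $p_v$, independently of all other edges, where $0<p_h\le p_v\le 1$. An open cluster is a connected subgraph $A=(V_A,E_A)$ of $\mathbb{L}^2$ all of whose edges are open and such that every edge of $\mathbb{L}^2$ with exactly one endpoint in $V_A$ is closed. Put $$\tau^f(y,z)=\mathbb{P}\big(\text{there is an open cluster } A \text{ with } \{y,z\}\subset V_A,\ |E_A|<\infty\big),\qquad \lambda_h=\tfrac{1-p_h}{p_h},\quad \lambda_v=\tfrac{1-p_v}{p_v}.$$ A contour is a finite set $\gamma\subset\mathbb{E}$ such that $(\mathbb{Z}^2,\mathbb{E}\setminus\gamma)$ has exactly one finite connected component, while for every $e\in\gamma$ the graph $(\mathbb{Z}^2,\mathbb{E}\setminus(\gamma\setminus\{e\}))$ has no finite connected component; it surrounds a set $X\subset\mathbb{Z}^2$ if $X$ is contained in the vertex set of that finite component. **Proposition.** Let $x_1,x_2\ge 1$ be integers, $x=(x_1,x_2)$, $x'=(x_2,x_1)$, $\|x\|=2(x_1+x_2+2)$,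 and let $\beta_x$ be the number of contours with exactly $\|x\|$ edges that surround $\{0,x\}$ (the minimal contours around $\{0,x\}$). Then $\beta_x$ is finite and $$\tau^f(0,x)\ \ge\ \beta_x\,\lambda_h^{2(x_2+1)}\lambda_v^{2(x_1+1)}p_h^{2\|x\|}.$$ If moreover $p_v<1$ and $\lambda_h<4^{-3}$, then $$\tau^f(0,x')\ <\ \lambda_h^{2(x_1+1)}\lambda_v^{2(x_2+1)}\left(\frac{(64\lambda_h)^{\|x\|/2+1}}{1-64\lambda_h}+\beta_x(1+12\lambda_h)^{\|x\|}\right).$$ -/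

import Mathlib

namespace AnisoPerc

open MeasureTheory ProbabilityTheory

/-- The square lattice: vertices `ℤ × ℤ`, with edges between nearest neighbours. -/
def lattice : SimpleGraph (ℤ × ℤ) where
  Adj x y := |x.1 - y.1| + |x.2 - y.2| = 1
  symm := ⟨fun x y h => by rw [abs_sub_comm y.1, abs_sub_comm y.2]; exact h⟩
  loopless := ⟨fun x h => by simp at h⟩

/-- An edge is horizontal if its endpoints have the same second coordinate; the other edges of the
lattice are the vertical ones. -/
def IsHorizontal (e : Sym2 (ℤ × ℤ)) : Prop :=
  ∀ u ∈ e, ∀ v ∈ e, u.2 = v.2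

/-- Configurations: `true` means open, `false` means closed. -/
abbrev Config : Type := lattice.edgeSet → Bool

open Classical in
/-- The Bernoulli law of one edge: open with probability `ph` if the edge is horizontal,
with probability `pv` if it is vertical. -/
noncomputable def edgeLaw (ph pv : unitInterval) (e : lattice.edgeSet) : Measure Bool :=
  bernoulliMeasure true false (if IsHorizontal e.1 then ph else pv)

instance (ph pv : unitInterval) (e : lattice.edgeSet) : IsProbabilityMeasure (edgeLaw ph pv e) := by
  unfold edgeLaw; infer_instance

/-- The percolation measure: the product of the edge laws. -/
noncomputable def percMeasure (ph pv : unitInterval) : Measure Config :=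
  Measure.infinitePi (edgeLaw ph pv)

instance (ph pv : unitInterval) : IsProbabilityMeasure (percMeasure ph pv) := by
  unfold percMeasure; infer_instance

/-- The edge boundary of a set `V` of vertices: the lattice edges with exactly one endpoint
in `V`. -/
def edgeBoundary (V : Set (ℤ × ℤ)) : Set (Sym2 (ℤ × ℤ)) :=
  {e | e ∈ lattice.edgeSet ∧ ∃! v, v ∈ e ∧ v ∈ V}

/-- `A` is an open cluster of `ω`: a connected subgraph of the lattice, all of whose edges are open,
and all of whose boundary edges are closed. -/
def IsOpenCluster (ω : Config) (A : lattice.Subgraph) : Prop :=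
  A.Connected ∧ (∀ e : lattice.edgeSet, e.1 ∈ A.edgeSet → ω e = true) ∧
    ∀ e : lattice.edgeSet, e.1 ∈ edgeBoundary A.verts → ω e = false

/-- The truncated connectivity function: the probability that `x` and `y` belong to the same finite
open cluster. -/
noncomputable def truncConn (ph pv : unitInterval) (x y : ℤ × ℤ) : ℝ :=
  (percMeasure ph pv).real
    {ω | ∃ A : lattice.Subgraph, IsOpenCluster ω A ∧ x ∈ A.verts ∧ y ∈ A.verts ∧ A.edgeSet.Finite}

/-- `λ = (1 - p) / p`. -/
noncomputable def lam (p : unitInterval) : ℝ := (1 - (p : ℝ)) / (p : ℝ)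

/-- A contour: a finite set `γ` of lattice edges whose removal leaves exactly one finite connected
component, such that after putting back any one edge of `γ` there is no finite component. -/
def IsContour (γ : Set (Sym2 (ℤ × ℤ))) : Prop :=
  γ ⊆ lattice.edgeSet ∧ γ.Finite ∧
    (∃! C : (lattice.deleteEdges γ).ConnectedComponent, C.supp.Finite) ∧
    ∀ e ∈ γ, ∀ C : (lattice.deleteEdges (γ \ {e})).ConnectedComponent, ¬ C.supp.Finite

/-- The vertex interior of a contour: the vertices in the finite component. -/
def interior (γ : Set (Sym2 (ℤ × ℤ))) : Set (ℤ × ℤ) :=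
  {v | ((lattice.deleteEdges γ).connectedComponentMk v).supp.Finite}

/-- The set of contours with `n` edges that surround `X`. -/
def contoursAround (X : Set (ℤ × ℤ)) (n : ℕ) : Set (Set (Sym2 (ℤ × ℤ))) :=
  {γ | IsContour γ ∧ X ⊆ interior γ ∧ γ.ncard = n}

/-- `‖x‖ = 2 (x₁ + x₂ + 2)`, the number of edges of a minimal contour around `{0, x}`. -/
def minLen (x₁ x₂ : ℕ) : ℕ := 2 * (x₁ + x₂ + 2)

/-- The set of minimal contours around `{0, x}`: those with `‖x‖` edges. -/
def minContours (x₁ x₂ : ℕ) : Set (Set (Sym2 (ℤ × ℤ))) :=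
  contoursAround {((0 : ℤ), (0 : ℤ)), ((x₁ : ℤ), (x₂ : ℤ))} (minLen x₁ x₂)

/-- `β_x`, the number of minimal contours around `{0, x}`. -/
noncomputable def beta (x₁ x₂ : ℕ) : ℕ := (minContours x₁ x₂).ncard

end AnisoPerc

namespace AnisoPerc

open MeasureTheory ProbabilityTheory

/-! ### Contours and regions -/

/-! Contours are the edge boundaries of regions, that is, of finite connected vertex sets without
holes (`edgeBoundary_interior`, `isContour_edgeBoundary`). The boundary of a region is one closed
dual walk with the region on its left (`exists_trace_eq`), so a contour is encoded by a starting
point and a word in the four headings. A contour around 0 and (m, n) makes at least m + 1 steps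
east, m + 1 west, n + 1 north and n + 1 south, and vertical dual steps cross horizontal lattice
edges; this gives the exponents of λ_h and λ_v.

Lower bound. A minimal contour uses each heading exactly the minimal number of times, so its two
halves are monotone and at most ‖x‖ inner edges join all vertices along it
(`exists_inner_of_mem_minContours`). If the contour is closed and these edges are open, the cluster
of 0 contains the inner boundary of the contour and stays in its interior. This determines the
contour (`subset_of_inner_boundary`), so the events for different minimal contours are disjoint and
their probabilities add up.

Upper bound. Filling the holes of a finite cluster gives a closed surrounding contour
(`exists_closed_contour`). A contour with ‖x‖ + d edges is closed with probability at most p_v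
λ_h^(2(n+1)) λ_v^(2(m+1)) λ_h^d, and there are two ways to count such contours. A closed walk
without reversals gives at most 4^(‖x‖+d), which is at most 64^d when d > ‖x‖/2. For d ≤ ‖x‖/2, each
half of the word is thinned to m + 1 east and n + 1 north steps in its own orientation: first
entries into columns and last exits from rows (`HalfPath.exists_word`). The two reduced words bound
a staircase region, hence a minimal contour, and the original word is recovered by inserting d
letters into a word of length ‖x‖. This costs at most (‖x‖ choose d) 12^d
(`ncard_contoursAround_le_beta`). Summing over d gives a geometric tail and a binomial sum. The
staircases are drawn reflected in the diagonal, so the count for the target x' is directly in terms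
of β_x. The strict inequality comes from the spare factor p_v < 1. -/

lemma mem_edgeBoundary {V : Set (ℤ × ℤ)} {u v : ℤ × ℤ} :
    s(u, v) ∈ edgeBoundary V ↔ lattice.Adj u v ∧ ¬ (u ∈ V ↔ v ∈ V) := by
  unfold edgeBoundary
  simp only [Set.mem_ofPred_eq, SimpleGraph.mem_edgeSet, Sym2.mem_iff]
  refine and_congr_right fun h => ?_
  have hne := h.ne
  constructor
  · rintro ⟨w, ⟨rfl | rfl, hw⟩, hu⟩ hiff
    · exact hne (hu v ⟨Or.inr rfl, hiff.1 hw⟩).symm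
    · exact hne (hu u ⟨Or.inl rfl, hiff.2 hw⟩)
  · intro hiff
    by_cases hu : u ∈ V
    · refine ⟨u, ⟨Or.inl rfl, hu⟩, ?_⟩
      rintro y ⟨rfl | rfl, hy⟩
      · rfl
      · exact absurd (iff_of_true hu hy) hiff
    · have hv : v ∈ V := by tauto
      refine ⟨v, ⟨Or.inr rfl, hv⟩, ?_⟩
      rintro y ⟨rfl | rfl, hy⟩
      · exact absurd hy hu
      · rfl

lemma exists_of_mem_edgeBoundary {V : Set (ℤ × ℤ)} {e : Sym2 (ℤ × ℤ)} (he : e ∈ edgeBoundary V) :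
    ∃ u w, e = s(u, w) ∧ lattice.Adj u w ∧ u ∈ V ∧ w ∉ V := by
  induction e using Sym2.ind with
  | _ u v =>
    obtain ⟨h1, h2⟩ := mem_edgeBoundary.1 he
    by_cases hu : u ∈ V
    · exact ⟨u, v, rfl, h1, hu, fun hv => h2 (iff_of_true hu hv)⟩
    · exact ⟨v, u, Sym2.eq_swap, h1.symm, by tauto, hu⟩

/-- The lattice with the boundary edges of `V` removed. -/
def cutGraph (V : Set (ℤ × ℤ)) : SimpleGraph (ℤ × ℤ) := lattice.deleteEdges (edgeBoundary V)

lemma cutGraph_adj {V : Set (ℤ × ℤ)} {u v : ℤ × ℤ} :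
    (cutGraph V).Adj u v ↔ lattice.Adj u v ∧ (u ∈ V ↔ v ∈ V) := by
  unfold cutGraph
  rw [SimpleGraph.deleteEdges_adj, mem_edgeBoundary]
  tauto

lemma supp_connectedComponentMk (G : SimpleGraph (ℤ × ℤ)) (v : ℤ × ℤ) :
    (G.connectedComponentMk v).supp = {w | G.Reachable v w} := by
  ext w
  rw [SimpleGraph.ConnectedComponent.mem_supp_iff, SimpleGraph.ConnectedComponent.eq]
  exact SimpleGraph.reachable_comm

lemma mem_of_reachable {G : SimpleGraph (ℤ × ℤ)} {S : Set (ℤ × ℤ)}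
    (hS : ∀ u w, u ∈ S → G.Adj u w → w ∈ S) {u w : ℤ × ℤ} (h : G.Reachable u w) (hu : u ∈ S) :
    w ∈ S := by
  rw [SimpleGraph.reachable_iff_reflTransGen] at h
  induction h with
  | refl => exact hu
  | tail _ hab ih => exact hS _ _ ih hab

/-- Finite connected sets of vertices all of whose complementary components are infinite. -/
structure IsRegion (V : Set (ℤ × ℤ)) : Prop where
  finite : V.Finite
  nonempty : V.Nonempty
  conn : ∀ u ∈ V, ∀ v ∈ V, (cutGraph V).Reachable u v
  compl : ∀ v, v ∉ V → {w | (cutGraph V).Reachable v w}.Infinite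

lemma cutGraph_reachable_iff {V : Set (ℤ × ℤ)} {u w : ℤ × ℤ} (h : (cutGraph V).Reachable u w) :
    u ∈ V ↔ w ∈ V :=
  ⟨fun hu => mem_of_reachable (S := V) (fun _ _ ha hab => (cutGraph_adj.1 hab).2.1 ha) h hu,
   fun hw => mem_of_reachable (S := V) (fun _ _ ha hab => (cutGraph_adj.1 hab).2.1 ha) h.symm hw⟩

/-- One half of the bijection between contours and regions. Edges leaving the finite component must
have been removed, and minimality rules out any other removed edge. -/
lemma edgeBoundary_interior {γ : Set (Sym2 (ℤ × ℤ))} (h : IsContour γ) :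
    edgeBoundary (interior γ) = γ := by
  obtain ⟨hsub, hfin, ⟨C, hC, hCu⟩, hmin⟩ := h
  have hint : ∀ v, v ∈ interior γ ↔ (lattice.deleteEdges γ).connectedComponentMk v = C := by
    intro v
    constructor
    · intro hv
      exact hCu _ hv
    · intro hv
      change (SimpleGraph.ConnectedComponent.supp _).Finite
      rw [hv]; exact hC
  have hcl : ∀ u w, (lattice.deleteEdges γ).Adj u w → (u ∈ interior γ ↔ w ∈ interior γ) := by
    intro u w huw
    rw [hint, hint, SimpleGraph.ConnectedComponent.sound huw.reachable]
  have hifin : (interior γ).Finite := by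
    refine hC.subset fun v hv => ?_
    rw [SimpleGraph.ConnectedComponent.mem_supp_iff]; exact (hint v).1 hv
  obtain ⟨v₀, hv₀⟩ := C.nonempty_supp
  rw [SimpleGraph.ConnectedComponent.mem_supp_iff] at hv₀
  ext e
  constructor
  · intro he
    obtain ⟨u, w, rfl, huw, hu, hw⟩ := exists_of_mem_edgeBoundary he
    by_contra hne
    exact hw ((hcl u w (by rw [SimpleGraph.deleteEdges_adj]; exact ⟨huw, hne⟩)).1 hu)
  · intro he
    induction e using Sym2.ind with
    | _ a b =>
      by_contra hne
      have hab : lattice.Adj a b := hsub he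
      rw [mem_edgeBoundary] at hne
      have hiff : a ∈ interior γ ↔ b ∈ interior γ := by tauto
      -- Putting back an edge whose ends lie on the same side leaves the interior closed under
      -- adjacency, so a finite component survives, against minimality.
      refine hmin _ he ((lattice.deleteEdges (γ \ {s(a, b)})).connectedComponentMk v₀) ?_
      rw [supp_connectedComponentMk]
      refine hifin.subset fun w hw => ?_
      refine mem_of_reachable (S := interior γ) ?_ hw ((hint _).2 hv₀)
      intro u w hu huw
      rw [SimpleGraph.deleteEdges_adj] at huw
      by_cases hcase : s(u, w) ∈ γ
      · have : s(u, w) = s(a, b) := by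
          by_contra h'
          exact huw.2 ⟨hcase, h'⟩
        rw [Sym2.eq_iff] at this
        rcases this with ⟨rfl, rfl⟩ | ⟨rfl, rfl⟩
        · exact hiff.1 hu
        · exact hiff.2 hu
      · exact (hcl u w (by rw [SimpleGraph.deleteEdges_adj]; exact ⟨huw.1, hcase⟩)).1 hu

lemma isRegion_interior {γ : Set (Sym2 (ℤ × ℤ))} (h : IsContour γ) : IsRegion (interior γ) := by
  have hb : cutGraph (interior γ) = lattice.deleteEdges γ := by
    unfold cutGraph; rw [edgeBoundary_interior h]
  obtain ⟨hsub, hfin, ⟨C, hC, hCu⟩, hmin⟩ := h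
  have hmk : ∀ v ∈ interior γ, (lattice.deleteEdges γ).connectedComponentMk v = C :=
    fun v hv => hCu _ hv
  refine ⟨?_, ?_, ?_, ?_⟩
  · refine hC.subset fun v hv => ?_
    rw [SimpleGraph.ConnectedComponent.mem_supp_iff]; exact hmk v hv
  · obtain ⟨v₀, hv₀⟩ := C.nonempty_supp
    rw [SimpleGraph.ConnectedComponent.mem_supp_iff] at hv₀
    refine ⟨v₀, ?_⟩
    change (SimpleGraph.ConnectedComponent.supp _).Finite
    rw [hv₀]; exact hC
  · intro u hu v hv
    rw [hb]
    exact SimpleGraph.ConnectedComponent.exact ((hmk u hu).trans (hmk v hv).symm)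
  · intro v hv
    rw [hb, ← supp_connectedComponentMk]
    exact hv

lemma interior_edgeBoundary {V : Set (ℤ × ℤ)} (h : IsRegion V) : interior (edgeBoundary V) = V := by
  ext v
  change ((cutGraph V).connectedComponentMk v).supp.Finite ↔ _
  rw [supp_connectedComponentMk]
  constructor
  · intro hf
    by_contra hv
    exact h.compl v hv hf
  · intro hv
    exact h.finite.subset fun w hw => (cutGraph_reachable_iff hw).1 hv

/-- The four lattice directions: east, north, west, south. -/
def vec : Fin 4 → ℤ × ℤ
  | 0 => (1, 0)
  | 1 => (0, 1)
  | 2 => (-1, 0)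
  | 3 => (0, -1)

@[simp] lemma vec_zero : vec 0 = (1, 0) := rfl
@[simp] lemma vec_one : vec 1 = (0, 1) := rfl
@[simp] lemma vec_two : vec 2 = (-1, 0) := rfl
@[simp] lemma vec_three : vec 3 = (0, -1) := rfl

lemma lattice_adj_iff {u v : ℤ × ℤ} : lattice.Adj u v ↔ |u.1 - v.1| + |u.2 - v.2| = 1 := Iff.rfl

lemma adj_add_vec (u : ℤ × ℤ) (k : Fin 4) : lattice.Adj u (u + vec k) := by
  rw [lattice_adj_iff]
  fin_cases k <;> simp

lemma exists_vec_of_adj {u v : ℤ × ℤ} (h : lattice.Adj u v) : ∃ k, v = u + vec k := by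
  obtain ⟨a, b⟩ := u
  obtain ⟨c, d⟩ := v
  rw [lattice_adj_iff] at h
  simp only at h
  have : (c = a + 1 ∧ d = b) ∨ (c = a ∧ d = b + 1) ∨ (c = a - 1 ∧ d = b) ∨
      (c = a ∧ d = b - 1) := by grind
  rcases this with ⟨rfl, rfl⟩ | ⟨rfl, rfl⟩ | ⟨rfl, rfl⟩ | ⟨rfl, rfl⟩
  · exact ⟨0, by simp⟩
  · exact ⟨1, by simp⟩
  · exact ⟨2, by ext <;> simp; ring⟩
  · exact ⟨3, by ext <;> simp; ring⟩

lemma edgeBoundary_finite {V : Set (ℤ × ℤ)} (h : V.Finite) : (edgeBoundary V).Finite := by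
  refine ((h.prod (Set.finite_univ (α := Fin 4))).image
    (fun p => s(p.1, p.1 + vec p.2))).subset fun e he => ?_
  obtain ⟨u, w, rfl, huw, hu, hw⟩ := exists_of_mem_edgeBoundary he
  obtain ⟨k, rfl⟩ := exists_vec_of_adj huw
  exact ⟨(u, k), ⟨hu, trivial⟩, rfl⟩

/-- The other half of the bijection: a boundary edge that is put back joins the connected set `V` to
an infinite outer component, so nothing finite remains. -/
lemma isContour_edgeBoundary {V : Set (ℤ × ℤ)} (h : IsRegion V) : IsContour (edgeBoundary V) := by
  obtain ⟨v₀, hv₀⟩ := h.nonempty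
  have hi := interior_edgeBoundary h
  refine ⟨fun e he => he.1, edgeBoundary_finite h.finite,
    ⟨(cutGraph V).connectedComponentMk v₀, ?_, ?_⟩, ?_⟩
  · have : v₀ ∈ interior (edgeBoundary V) := by rw [hi]; exact hv₀
    exact this
  · intro C
    induction C using SimpleGraph.ConnectedComponent.ind with
    | _ v =>
      intro hv
      have : v ∈ interior (edgeBoundary V) := hv
      rw [hi] at this
      exact SimpleGraph.ConnectedComponent.sound (h.conn v this v₀ hv₀)
  · intro e he C
    have hle : cutGraph V ≤ lattice.deleteEdges (edgeBoundary V \ {e}) :=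
      SimpleGraph.deleteEdges_anti Set.sdiff_subset
    have key : ∀ v, v ∉ V →
        ¬ ((lattice.deleteEdges (edgeBoundary V \ {e})).connectedComponentMk v).supp.Finite := by
      intro v hv hf
      rw [supp_connectedComponentMk] at hf
      exact h.compl v hv (hf.subset fun w (hw : (cutGraph V).Reachable v w) => hw.mono hle)
    induction C using SimpleGraph.ConnectedComponent.ind with
    | _ v =>
      by_cases hv : v ∈ V
      · obtain ⟨u, w, rfl, huw, hu, hw⟩ := exists_of_mem_edgeBoundary he
        have hr : (lattice.deleteEdges (edgeBoundary V \ {s(u, w)})).Reachable v w := by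
          refine ((h.conn v hv u hu).mono hle).trans (SimpleGraph.Adj.reachable ?_)
          rw [SimpleGraph.deleteEdges_adj]
          exact ⟨huw, fun hc => hc.2 rfl⟩
        rw [SimpleGraph.ConnectedComponent.sound hr]
        exact key w hw
      · exact key v hv

/-- Integer functions that agree at adjacent points of a region are constant on it. -/
lemma IsRegion.const {V : Set (ℤ × ℤ)} (h : IsRegion V) (f : ℤ × ℤ → ℤ)
    (hf : ∀ u ∈ V, ∀ v ∈ V, lattice.Adj u v → f u = f v) : ∀ u ∈ V, ∀ v ∈ V, f u = f v := by
  intro u hu v hv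
  have := mem_of_reachable (S := {w | w ∈ V ∧ f u = f w}) ?_ (h.conn u hu v hv) ⟨hu, rfl⟩
  · exact this.2
  · rintro a b ⟨ha, hab⟩ hadj
    obtain ⟨h1, h2⟩ := cutGraph_adj.1 hadj
    exact ⟨h2.1 ha, hab.trans (hf a ha b (h2.1 ha) h1)⟩

lemma exists_edge_leaving {C : Set (ℤ × ℤ)} (hC : C.Finite) (hne : C.Nonempty) :
    ∃ u w, u ∈ C ∧ w ∉ C ∧ lattice.Adj u w := by
  obtain ⟨u, hu, hmax⟩ := Set.exists_max_image C (fun p => p.1) hC hne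
  refine ⟨u, u + vec 0, hu, fun hw => ?_, adj_add_vec u 0⟩
  have := hmax _ hw
  simp at this

lemma reachable_ray {G : SimpleGraph (ℤ × ℤ)} {v : ℤ × ℤ} {k : Fin 4}
    (h : ∀ n : ℕ, G.Adj (v + n • vec k) (v + (n + 1) • vec k)) (n : ℕ) :
    G.Reachable v (v + n • vec k) := by
  induction n with
  | zero => simp
  | succ n ih => exact ih.trans (h n).reachable

lemma vec_ne_zero (k : Fin 4) : vec k ≠ 0 := by fin_cases k <;> simp

/-- A vertex from which a ray avoids `V` lies in an infinite component. -/
lemma infinite_of_ray {V : Set (ℤ × ℤ)} {v : ℤ × ℤ} {k : Fin 4}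
    (h : ∀ n : ℕ, v + n • vec k ∉ V) : {w | (cutGraph V).Reachable v w}.Infinite := by
  refine (Set.infinite_range_of_injective (f := fun n : ℕ => v + n • vec k) ?_).mono ?_
  · intro m n hmn
    have : (m : ℤ) • vec k = (n : ℤ) • vec k := by simpa using hmn
    have h2 := sub_eq_zero.2 this
    rw [← sub_smul, smul_eq_zero] at h2
    rcases h2 with h2 | h2
    · omega
    · exact absurd h2 (vec_ne_zero k)
  · rintro _ ⟨n, rfl⟩
    refine reachable_ray (fun m => ?_) n
    rw [cutGraph_adj]
    refine ⟨?_, iff_of_false (h m) (by exact_mod_cast h (m + 1))⟩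
    rw [succ_nsmul, ← add_assoc]
    exact adj_add_vec _ k

/-- Filling in the finite complementary components of a finite connected set gives a region. -/
lemma exists_isRegion_of_connected {K : Set (ℤ × ℤ)} (hK : K.Finite) (hne : K.Nonempty)
    (hconn : ∀ u ∈ K, ∀ v ∈ K, (cutGraph K).Reachable u v) :
    ∃ V, IsRegion V ∧ K ⊆ V ∧ edgeBoundary V ⊆ edgeBoundary K := by
  set V : Set (ℤ × ℤ) := {v | {w | (cutGraph K).Reachable v w}.Finite} with hV
  have hKV : K ⊆ V := fun k hk => hK.subset fun w hw => (cutGraph_reachable_iff hw).1 hk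
  have hmem : ∀ u w, (cutGraph K).Reachable u w → (u ∈ V ↔ w ∈ V) := by
    intro u w huw
    have : {x | (cutGraph K).Reachable u x} = {x | (cutGraph K).Reachable w x} := by
      ext x; exact ⟨fun h => huw.symm.trans h, fun h => huw.trans h⟩
    simp only [hV, Set.mem_ofPred_eq, this]
  have hbd : edgeBoundary V ⊆ edgeBoundary K := by
    intro e he
    obtain ⟨u, w, rfl, huw, hu, hw⟩ := exists_of_mem_edgeBoundary he
    by_contra hc
    rw [mem_edgeBoundary] at hc
    have : (cutGraph K).Adj u w := cutGraph_adj.2 ⟨huw, by tauto⟩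
    exact hw ((hmem _ _ this.reachable).1 hu)
  have hle : cutGraph K ≤ cutGraph V := SimpleGraph.deleteEdges_anti hbd
  obtain ⟨k₀, hk₀⟩ := hne
  have hreach : ∀ v ∈ V, (cutGraph V).Reachable v k₀ := by
    intro v hv
    -- The component of `v` is finite, so a lattice edge leaves it. That edge was cut, hence one of
    -- its ends lies in `K`, and `K` is connected.
    obtain ⟨u, w, hu, hw, huw⟩ := exists_edge_leaving hv ⟨v, SimpleGraph.Reachable.refl v⟩
    have hu' : (cutGraph K).Reachable v u := hu
    have hnadj : ¬ (cutGraph K).Adj u w := fun h => hw (hu'.trans h.reachable)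
    rw [cutGraph_adj] at hnadj
    by_cases huK : u ∈ K
    · exact (hu'.trans (hconn u huK k₀ hk₀)).mono hle
    · have hwK : w ∈ K := by tauto
      refine ((hu'.mono hle).trans (SimpleGraph.Adj.reachable ?_)).trans
        ((hconn w hwK k₀ hk₀).mono hle)
      exact cutGraph_adj.2 ⟨huw, iff_of_true ((hmem _ _ hu').1 hv) (hKV hwK)⟩
  refine ⟨V, ⟨?_, ⟨k₀, hKV hk₀⟩, ?_, ?_⟩, hKV, hbd⟩
  · obtain ⟨N, hN⟩ : ∃ N : ℤ, ∀ v ∈ K, |v.1| ≤ N ∧ |v.2| ≤ N := by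
      obtain ⟨N₁, h₁⟩ := (hK.image fun v => |v.1|).bddAbove
      obtain ⟨N₂, h₂⟩ := (hK.image fun v => |v.2|).bddAbove
      refine ⟨max N₁ N₂, fun v hv => ⟨?_, ?_⟩⟩
      · exact (h₁ ⟨v, hv, rfl⟩).trans (le_max_left _ _)
      · exact (h₂ ⟨v, hv, rfl⟩).trans (le_max_right _ _)
    refine ((Set.finite_Icc (-N) N).prod (Set.finite_Icc (-N) N)).subset fun v hv => ?_
    by_contra hc
    -- Outside a box containing `K` some coordinate ray misses `K`, so the component is infinite;
    -- hence the filled set stays in the box.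
    have hray : ∃ k : Fin 4, ∀ n : ℕ, v + n • vec k ∉ K := by
      have : N < v.1 ∨ N < v.2 ∨ v.1 < -N ∨ v.2 < -N := by
        simp only [Set.mem_prod, Set.mem_Icc] at hc
        omega
      rcases this with h | h | h | h
      · refine ⟨0, fun n hn => ?_⟩
        have := abs_le.1 (hN _ hn).1
        simp at this; omega
      · refine ⟨1, fun n hn => ?_⟩
        have := abs_le.1 (hN _ hn).2
        simp at this; omega
      · refine ⟨2, fun n hn => ?_⟩
        have := abs_le.1 (hN _ hn).1
        simp at this; omega
      · refine ⟨3, fun n hn => ?_⟩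
        have := abs_le.1 (hN _ hn).2
        simp at this; omega
    obtain ⟨k, hk⟩ := hray
    exact infinite_of_ray hk hv
  · intro u hu v hv
    exact (hreach u hu).trans (hreach v hv).symm
  · intro v hv
    have hv' : {w | (cutGraph K).Reachable v w}.Infinite := hv
    exact hv'.mono fun w hw => SimpleGraph.Reachable.mono hle hw

/-! ### Tracing the boundary of a region counterclockwise

A state `(u, k)` is a dual step with heading `k` that has the vertex `u` on its left. Dual vertices
are labelled by the vertex to their upper right. -/

/-- The offset of the starting point of the dual step with heading `k` along a vertex. -/
def corner : Fin 4 → ℤ × ℤ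
  | 0 => (0, 0)
  | 1 => (1, 0)
  | 2 => (1, 1)
  | 3 => (0, 1)

@[simp] lemma corner_zero : corner 0 = (0, 0) := rfl
@[simp] lemma corner_one : corner 1 = (1, 0) := rfl
@[simp] lemma corner_two : corner 2 = (1, 1) := rfl
@[simp] lemma corner_three : corner 3 = (0, 1) := rfl

/-- Boundary states: an inner vertex and a heading. -/
abbrev State : Type := (ℤ × ℤ) × Fin 4

/-- The starting point of a dual step. -/
def State.tail (s : State) : ℤ × ℤ := s.1 + corner s.2

/-- The vertex to the right of a dual step. -/
def State.out (s : State) : ℤ × ℤ := s.1 + vec (s.2 + 3)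

/-- The lattice edge crossed by a dual step. -/
def State.edge (s : State) : Sym2 (ℤ × ℤ) := s(s.1, s.out)

/-- A state is valid for `V` if it has a point of `V` on its left and none on its right. -/
def State.Valid (V : Set (ℤ × ℤ)) (s : State) : Prop := s.1 ∈ V ∧ s.out ∉ V

lemma vec_add_two (k : Fin 4) : vec (k + 2) = - vec k := by
  fin_cases k <;> ext <;> simp

lemma State.Valid.edge_mem {V : Set (ℤ × ℤ)} {s : State} (h : s.Valid V) :
    s.edge ∈ edgeBoundary V :=
  mem_edgeBoundary.2 ⟨adj_add_vec _ _, fun hc => h.2 (hc.1 h.1)⟩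

lemma exists_valid_of_mem_edgeBoundary {V : Set (ℤ × ℤ)} {e : Sym2 (ℤ × ℤ)}
    (he : e ∈ edgeBoundary V) : ∃ s : State, s.Valid V ∧ s.edge = e := by
  obtain ⟨u, w, rfl, huw, hu, hw⟩ := exists_of_mem_edgeBoundary he
  obtain ⟨k, rfl⟩ := exists_vec_of_adj huw
  have hk : k + 1 + 3 = k := by fin_cases k <;> rfl
  refine ⟨(u, k + 1), ⟨hu, ?_⟩, ?_⟩
  · simpa [State.out, hk] using hw
  · simp [State.edge, State.out, hk]

lemma vec_injective : Function.Injective vec := by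
  intro k l h
  fin_cases k <;> fin_cases l <;> simp at h ⊢

lemma edge_injOn (V : Set (ℤ × ℤ)) : Set.InjOn State.edge {s | s.Valid V} := by
  rintro ⟨u, k⟩ ⟨hu, hu'⟩ ⟨w, l⟩ ⟨hw, hw'⟩ h
  unfold State.edge at h
  rw [Sym2.eq_iff] at h
  rcases h with ⟨h1, h2⟩ | ⟨h1, h2⟩
  · simp only at h1
    subst h1
    simp only [State.out, add_right_inj] at h2
    have := add_right_cancel (vec_injective h2)
    rw [this]
  · rw [h1] at hu; exact absurd hu hw'

lemma valid_finite {V : Set (ℤ × ℤ)} (h : V.Finite) : {s : State | s.Valid V}.Finite :=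
  (h.prod (Set.finite_univ (α := Fin 4))).subset fun _ hs => ⟨hs.1, trivial⟩

open Classical in
/-- The boundary step following `s`, keeping `V` on the left. -/
noncomputable def next (V : Set (ℤ × ℤ)) (s : State) : State :=
  if s.1 + vec s.2 ∉ V then (s.1, s.2 + 1)
  else if s.1 + vec s.2 + vec (s.2 + 3) ∉ V then (s.1 + vec s.2, s.2)
  else (s.1 + vec s.2 + vec (s.2 + 3), s.2 + 3)

lemma next_cases (V : Set (ℤ × ℤ)) (s : State) :
    (s.1 + vec s.2 ∉ V ∧ next V s = (s.1, s.2 + 1)) ∨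
    (s.1 + vec s.2 ∈ V ∧ s.1 + vec s.2 + vec (s.2 + 3) ∉ V ∧ next V s = (s.1 + vec s.2, s.2)) ∨
    (s.1 + vec s.2 ∈ V ∧ s.1 + vec s.2 + vec (s.2 + 3) ∈ V ∧
      next V s = (s.1 + vec s.2 + vec (s.2 + 3), s.2 + 3)) := by
  unfold next
  by_cases h1 : s.1 + vec s.2 ∈ V
  · by_cases h2 : s.1 + vec s.2 + vec (s.2 + 3) ∈ V
    · right; right; simp [h1, h2]
    · right; left; simp [h1, h2]
  · left; simp [h1]

lemma tail_next (V : Set (ℤ × ℤ)) (s : State) : (next V s).tail = s.tail + vec s.2 := by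
  obtain ⟨u, k⟩ := s
  rcases next_cases V (u, k) with ⟨_, h⟩ | ⟨_, _, h⟩ | ⟨_, _, h⟩ <;> rw [h] <;>
    fin_cases k <;> ext <;> simp [State.tail]

lemma next_heading (V : Set (ℤ × ℤ)) (s : State) : (next V s).2 ≠ s.2 + 2 := by
  obtain ⟨u, k⟩ := s
  rcases next_cases V (u, k) with ⟨_, h⟩ | ⟨_, _, h⟩ | ⟨_, _, h⟩ <;> rw [h] <;>
    fin_cases k <;> simp

lemma next_valid {V : Set (ℤ × ℤ)} {s : State} (hs : s.Valid V) : (next V s).Valid V := by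
  obtain ⟨u, k⟩ := s
  obtain ⟨h0, h0'⟩ := hs
  rcases next_cases V (u, k) with ⟨h1, h⟩ | ⟨h1, h2, h⟩ | ⟨h1, h2, h⟩ <;> rw [h]
  · refine ⟨h0, ?_⟩
    have : k + 1 + 3 = k := by fin_cases k <;> rfl
    simpa [State.out, this] using h1
  · exact ⟨h1, h2⟩
  · refine ⟨h2, ?_⟩
    have : u + vec k + vec (k + 3) + vec (k + 3 + 3) = u + vec (k + 3) := by
      fin_cases k <;> ext <;> simp
    simpa [State.out, this] using h0'

lemma fin_four_add (k : Fin 4) : k + 1 + 3 = k ∧ k + 3 + 1 = k ∧ k + 3 + 3 = k + 2 ∧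
    k + 1 + 1 = k + 2 := by
  fin_cases k <;> decide

lemma next_injOn (V : Set (ℤ × ℤ)) : Set.InjOn (next V) {s | s.Valid V} := by
  classical
  -- The boundary rule can be run backwards by inspecting the two vertices behind the step; on valid
  -- states this is a left inverse of `next V`.
  let prev : State → State := fun s =>
    if s.1 - vec s.2 ∉ V then (s.1, s.2 + 3)
    else if s.1 - vec s.2 + vec (s.2 + 3) ∉ V then (s.1 - vec s.2, s.2)
    else (s.1 - vec s.2 + vec (s.2 + 3), s.2 + 1)
  refine Set.LeftInvOn.injOn (f₁' := prev) ?_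
  rintro ⟨u, k⟩ ⟨hu, hu'⟩
  simp only [State.out] at hu hu'
  obtain ⟨e1, e2, e3, e4⟩ := fin_four_add k
  rcases next_cases V (u, k) with ⟨h1, h⟩ | ⟨h1, h2, h⟩ | ⟨h1, h2, h⟩ <;> rw [h]
  · have : u - vec (k + 1) = u + vec (k + 3) := by
      fin_cases k <;> ext <;> simp [sub_eq_add_neg]
    simp [prev, this, hu', e1]
  · simp [prev, hu, hu']
  · have h3 : u + vec k + vec (k + 3) - vec (k + 3) = u + vec k := by simp
    have h4 : u + vec k + vec (k + 3) - vec (k + 3) + vec (k + 3 + 3) = u := by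
      rw [h3, e3, vec_add_two]; simp
    simp only at h1 h2
    have h5 : u + vec k + vec (k + 3 + 3) = u := by rw [← h3, h4]
    simp only [prev, h3, h1, e2]
    simp [h5, hu]

/-! ### Crossing numbers -/

/-- The signed contribution of a dual step to the number of eastward crossings of the vertical
half-line going down from `v`. -/
def State.flow (s : State) (v : ℤ × ℤ) : ℤ :=
  if s.2 = 0 ∧ s.tail.1 = v.1 ∧ s.tail.2 ≤ v.2 then 1
  else if s.2 = 2 ∧ s.tail.1 = v.1 + 1 ∧ s.tail.2 ≤ v.2 then -1 else 0

/-- The signed crossing of the pair `(u, v)` by a dual step: `1` if `u` is on its left. -/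
def State.cross (s : State) (u v : ℤ × ℤ) : ℤ :=
  (if s.1 = u ∧ s.out = v then 1 else 0) - (if s.1 = v ∧ s.out = u then 1 else 0)

/-- The indicator of the dual vertices on the right of column `a`, not above level `b`. -/
def wall (a b : ℤ) (z : ℤ × ℤ) : ℤ := if z.1 = a + 1 ∧ z.2 ≤ b then 1 else 0

/-- A conservation law: the dual vertices marked by `wall a b` form the strip between the half-lines
below (a, b) and (a + 1, b). A step changes this indicator only by passing the left side, the right
side or the top of the strip. -/
lemma flow_sub_flow_east (s : State) (a b : ℤ) :
    s.flow (a, b) - s.flow (a + 1, b) =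
      s.cross (a, b) (a + 1, b) + (wall a b (s.tail + vec s.2) - wall a b s.tail) := by
  obtain ⟨⟨p, q⟩, k⟩ := s
  fin_cases k <;> simp [State.flow, State.cross, wall, State.tail, State.out] <;> split_ifs <;> omega

lemma flow_sub_flow_south (s : State) (a b : ℤ) :
    s.flow (a, b) - s.flow (a, b - 1) = s.cross (a, b) (a, b - 1) := by
  obtain ⟨⟨p, q⟩, k⟩ := s
  fin_cases k <;> simp [State.flow, State.cross, State.tail, State.out] <;> split_ifs <;> omega

lemma State.cross_eq_zero {V : Set (ℤ × ℤ)} {s : State} (hs : s.Valid V) {u v : ℤ × ℤ}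
    (h : u ∈ V ↔ v ∈ V) : s.cross u v = 0 := by
  obtain ⟨h1, h2⟩ := hs
  unfold State.cross
  rw [if_neg, if_neg, sub_zero]
  · rintro ⟨rfl, rfl⟩; exact h2 (h.2 h1)
  · rintro ⟨rfl, rfl⟩; exact h2 (h.1 h1)

/-- A crossing of the inner and outer vertices of a valid state is made by that state only. -/
lemma State.cross_out {V : Set (ℤ × ℤ)} {s t : State} (hs : s.Valid V) (ht : t.Valid V) :
    s.cross t.1 t.out = if s = t then 1 else 0 := by
  unfold State.cross
  rw [if_neg (c := s.1 = t.out ∧ s.out = t.1), sub_zero]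
  · congr 1
    refine propext ⟨fun h => ?_, fun h => by rw [h]; exact ⟨rfl, rfl⟩⟩
    refine edge_injOn V hs ht ?_
    unfold State.edge
    rw [h.1, h.2]
  · rintro ⟨h1, -⟩
    exact ht.2 (h1 ▸ hs.1)

/-- The total flow of the first `T` steps of a sequence of states. -/
def flowSum (s : ℕ → State) (T : ℕ) (v : ℤ × ℤ) : ℤ := ∑ t ∈ Finset.range T, (s t).flow v

lemma flowSum_sub_east {s : ℕ → State} {T : ℕ}
    (hs : ∀ t < T, (s (t + 1)).tail = (s t).tail + vec (s t).2) (a b : ℤ) :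
    flowSum s T (a, b) - flowSum s T (a + 1, b) =
      ∑ t ∈ Finset.range T, (s t).cross (a, b) (a + 1, b) +
        (wall a b (s T).tail - wall a b (s 0).tail) := by
  unfold flowSum
  rw [← Finset.sum_sub_distrib, ← Finset.sum_range_sub (fun t => wall a b (s t).tail),
    ← Finset.sum_add_distrib]
  refine Finset.sum_congr rfl fun t ht => ?_
  rw [hs t (Finset.mem_range.1 ht), flow_sub_flow_east]

lemma flowSum_sub_south (s : ℕ → State) (T : ℕ) (a b : ℤ) :
    flowSum s T (a, b) - flowSum s T (a, b - 1) =
      ∑ t ∈ Finset.range T, (s t).cross (a, b) (a, b - 1) := by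
  unfold flowSum
  rw [← Finset.sum_sub_distrib]
  exact Finset.sum_congr rfl fun t _ => flow_sub_flow_south _ _ _

/-- Eastward crossings of a whole column telescope. -/
lemma sum_flow_column {s : ℕ → State} {T : ℕ}
    (hs : ∀ t < T, (s (t + 1)).tail = (s t).tail + vec (s t).2) (a b : ℤ)
    (hb : ∀ t < T, (s t).tail.2 ≤ b) :
    flowSum s T (a, b) = (if a < (s T).tail.1 then 1 else 0) - (if a < (s 0).tail.1 then 1 else 0) := by
  unfold flowSum
  rw [← Finset.sum_range_sub (fun t => if a < (s t).tail.1 then (1 : ℤ) else 0)]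
  refine Finset.sum_congr rfl fun t ht => ?_
  have h1 := hb t (Finset.mem_range.1 ht)
  rw [hs t (Finset.mem_range.1 ht)]
  unfold State.flow
  generalize (s t).tail = z at *
  generalize (s t).2 = k at *
  obtain ⟨p, q⟩ := z
  simp only at h1
  fin_cases k <;> simp <;> split_ifs <;> omega

/-! ### The boundary of a region is a single cycle -/

/-- The boundary trace started at `s₀`. -/
noncomputable def trace (V : Set (ℤ × ℤ)) (s₀ : State) (t : ℕ) : State := (next V)^[t] s₀

lemma trace_zero (V : Set (ℤ × ℤ)) (s₀ : State) : trace V s₀ 0 = s₀ := rfl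

lemma trace_succ (V : Set (ℤ × ℤ)) (s₀ : State) (t : ℕ) :
    trace V s₀ (t + 1) = next V (trace V s₀ t) := Function.iterate_succ_apply' _ _ _

lemma trace_valid {V : Set (ℤ × ℤ)} {s₀ : State} (h : s₀.Valid V) (t : ℕ) :
    (trace V s₀ t).Valid V := by
  induction t with
  | zero => exact h
  | succ t ih => rw [trace_succ]; exact next_valid ih

lemma trace_tail (V : Set (ℤ × ℤ)) (s₀ : State) (t : ℕ) :
    (trace V s₀ (t + 1)).tail = (trace V s₀ t).tail + vec (trace V s₀ t).2 := by
  rw [trace_succ, tail_next]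

lemma trace_cancel {V : Set (ℤ × ℤ)} {s₀ : State} (h : s₀.Valid V) {m n : ℕ}
    (hmn : trace V s₀ m = trace V s₀ (m + n)) : trace V s₀ n = s₀ := by
  induction m with
  | zero => rw [zero_add] at hmn; exact hmn.symm
  | succ m ih =>
    refine ih (next_injOn V (trace_valid h _) (trace_valid h _) ?_)
    rw [← trace_succ, ← trace_succ, hmn]
    congr 1; omega

/-- The length of the boundary cycle through `s₀`. -/
noncomputable def period (V : Set (ℤ × ℤ)) (s₀ : State) : ℕ :=
  Function.minimalPeriod (next V) s₀

lemma period_pos {V : Set (ℤ × ℤ)} (hV : V.Finite) {s₀ : State} (h : s₀.Valid V) :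
    0 < period V s₀ := by
  obtain ⟨m, n, hmn, heq⟩ := (valid_finite hV).exists_lt_map_eq_of_forall_mem
    (f := trace V s₀) (trace_valid h)
  refine Function.minimalPeriod_pos_of_mem_periodicPts
    (Function.mk_mem_periodicPts (n := n - m) (by omega) ?_)
  refine trace_cancel h (m := m) ?_
  rw [heq]; congr 1; omega

lemma trace_period (V : Set (ℤ × ℤ)) (s₀ : State) : trace V s₀ (period V s₀) = s₀ :=
  Function.iterate_minimalPeriod

lemma trace_injOn {V : Set (ℤ × ℤ)} {s₀ : State} :
    Set.InjOn (trace V s₀) (Set.Iio (period V s₀)) :=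
  Function.iterate_injOn_Iio_minimalPeriod

lemma trace_mod (V : Set (ℤ × ℤ)) (s₀ : State) (t : ℕ) :
    trace V s₀ (t % period V s₀) = trace V s₀ t :=
  Function.iterate_mod_minimalPeriod_eq

lemma State.cross_swap (s : State) (u v : ℤ × ℤ) : s.cross u v = - s.cross v u := by
  unfold State.cross; ring

/-- Along a closed sequence of dual steps the flow changes by the number of crossings. -/
lemma flowSum_sub_adj {s : ℕ → State} {T : ℕ}
    (hs : ∀ t < T, (s (t + 1)).tail = (s t).tail + vec (s t).2) (hc : (s T).tail = (s 0).tail)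
    (u v : ℤ × ℤ) (huv : lattice.Adj u v) :
    flowSum s T u - flowSum s T v = ∑ t ∈ Finset.range T, (s t).cross u v := by
  have east : ∀ a b, flowSum s T (a, b) - flowSum s T (a + 1, b) =
      ∑ t ∈ Finset.range T, (s t).cross (a, b) (a + 1, b) := by
    intro a b
    rw [flowSum_sub_east hs, hc, sub_self, add_zero]
  have south := flowSum_sub_south s T
  have swap : ∀ a b : ℤ × ℤ, ∑ t ∈ Finset.range T, (s t).cross a b =
      - ∑ t ∈ Finset.range T, (s t).cross b a := by
    intro a b
    rw [← Finset.sum_neg_distrib]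
    exact Finset.sum_congr rfl fun t _ => State.cross_swap _ _ _
  obtain ⟨k, rfl⟩ := exists_vec_of_adj huv
  obtain ⟨a, b⟩ := u
  fin_cases k
  · simpa using east a b
  · have := south a (b + 1)
    rw [add_sub_cancel_right, swap] at this
    simp; linarith
  · have := east (a - 1) b
    rw [sub_add_cancel, swap] at this
    simp [← sub_eq_add_neg]; linarith
  · simpa [← sub_eq_add_neg] using south a b

/-- Above the walk the crossings of a full column telescope to zero, since the walk is closed; to
the sides and below there are no crossings at all. -/
lemma flowSum_support_finite {s : ℕ → State} {T : ℕ}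
    (hs : ∀ t < T, (s (t + 1)).tail = (s t).tail + vec (s t).2) (hc : (s T).tail = (s 0).tail) :
    {v | flowSum s T v ≠ 0}.Finite := by
  obtain ⟨B, hB⟩ : ∃ B : ℤ, ∀ t < T, |(s t).tail.1| ≤ B ∧ |(s t).tail.2| ≤ B := by
    obtain ⟨N₁, h₁⟩ := ((Set.finite_Iio T).image fun t => |(s t).tail.1|).bddAbove
    obtain ⟨N₂, h₂⟩ := ((Set.finite_Iio T).image fun t => |(s t).tail.2|).bddAbove
    refine ⟨max N₁ N₂, fun t ht => ⟨?_, ?_⟩⟩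
    · exact (h₁ ⟨t, ht, rfl⟩).trans (le_max_left _ _)
    · exact (h₂ ⟨t, ht, rfl⟩).trans (le_max_right _ _)
  refine ((Set.finite_Icc (-B - 1) B).prod (Set.finite_Icc (-B) B)).subset ?_
  rintro ⟨a, b⟩ hv
  by_contra hcon
  apply hv
  by_cases hb : B ≤ b
  · rw [sum_flow_column hs a b fun t ht => ?_, hc, sub_self]
    exact (abs_le.1 (hB t ht).2).2.trans hb
  · refine Finset.sum_eq_zero fun t ht => ?_
    have h1 := abs_le.1 (hB t (Finset.mem_range.1 ht)).1
    have h2 := abs_le.1 (hB t (Finset.mem_range.1 ht)).2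
    simp only [Set.mem_prod, Set.mem_Icc] at hcon
    unfold State.flow
    rw [if_neg, if_neg]
    · rintro ⟨-, h3, h4⟩; simp only at h3 h4; omega
    · rintro ⟨-, h3, h4⟩; simp only at h3 h4; omega

/-- Every boundary state of a region lies on the cycle of any other one. -/
theorem exists_trace_eq {V : Set (ℤ × ℤ)} (hV : IsRegion V) {s₀ s : State} (h₀ : s₀.Valid V)
    (hs : s.Valid V) : ∃ t < period V s₀, trace V s₀ t = s := by
  by_contra hcon
  push Not at hcon
  set L := period V s₀
  have hstep : ∀ t < L, (trace V s₀ (t + 1)).tail = (trace V s₀ t).tail + vec (trace V s₀ t).2 :=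
    fun t _ => trace_tail V s₀ t
  have hclosed : (trace V s₀ L).tail = (trace V s₀ 0).tail := by
    rw [trace_period, trace_zero]
  -- `F` is the winding number of the cycle through `s₀`, which jumps only across the edges that the
  -- cycle crosses.
  set F := flowSum (trace V s₀) L with hF
  have hadj : ∀ u v, lattice.Adj u v → F u - F v = ∑ t ∈ Finset.range L, (trace V s₀ t).cross u v :=
    flowSum_sub_adj hstep hclosed
  have heq : ∀ u v, lattice.Adj u v → (u ∈ V ↔ v ∈ V) → F u = F v := by
    intro u v huv hiff
    have := hadj u v huv
    rw [Finset.sum_eq_zero fun t _ => State.cross_eq_zero (trace_valid h₀ t) hiff] at this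
    linarith
  -- `F` is constant on complementary components; these are infinite, while `F` has finite support.
  have hout : ∀ v, v ∉ V → F v = 0 := by
    intro v hv
    obtain ⟨w, hw, hw'⟩ := ((hV.compl v hv).sdiff (flowSum_support_finite hstep hclosed)).nonempty
    have h1 : F w = 0 := by simpa using hw'
    have := mem_of_reachable (S := {x | F v = F x}) ?_ hw rfl
    · rw [← h1]; exact this
    · intro a b ha hab
      obtain ⟨h2, h3⟩ := cutGraph_adj.1 hab
      exact Eq.trans ha (heq a b h2 h3)
  -- The outer end contributes 0, so the value at the inner end counts the visits of the cycle to
  -- `s'`: one for `s₀` and none for a state off the cycle. As `F` is constant on `V`, no state can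
  -- be off the cycle.
  have hsum : ∀ s' : State, s'.Valid V → F s'.1 =
      ∑ t ∈ Finset.range L, if trace V s₀ t = s' then (1 : ℤ) else 0 := by
    intro s' hs'
    have := hadj s'.1 s'.out (adj_add_vec _ _)
    rw [hout _ hs'.2, sub_zero] at this
    rw [this]
    exact Finset.sum_congr rfl fun t _ => State.cross_out (trace_valid h₀ t) hs'
  have h1 : F s₀.1 = 1 := by
    rw [hsum s₀ h₀, Finset.sum_eq_single 0]
    · simp [trace_zero]
    · intro t ht h0
      rw [if_neg]
      intro he
      exact h0 (trace_injOn (Finset.mem_range.1 ht) (period_pos hV.finite h₀) he)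
    · intro h
      exact absurd (Finset.mem_range.2 (period_pos hV.finite h₀)) h
  have h2 : F s.1 = 0 := by
    rw [hsum s hs]
    refine Finset.sum_eq_zero fun t ht => ?_
    rw [if_neg (hcon t (Finset.mem_range.1 ht))]
  have := hV.const F (fun u hu v hv huv => heq u v huv (iff_of_true hu hv)) s₀.1 h₀.1 s.1 hs.1
  omega

lemma edgeBoundary_eq_image {V : Set (ℤ × ℤ)} (hV : IsRegion V) {s₀ : State} (h₀ : s₀.Valid V) :
    edgeBoundary V = (fun t => (trace V s₀ t).edge) '' Set.Iio (period V s₀) := by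
  ext e
  constructor
  · intro he
    obtain ⟨s, hs, rfl⟩ := exists_valid_of_mem_edgeBoundary he
    obtain ⟨t, ht, rfl⟩ := exists_trace_eq hV h₀ hs
    exact ⟨t, ht, rfl⟩
  · rintro ⟨t, -, rfl⟩
    exact (trace_valid h₀ t).edge_mem

lemma edge_trace_injOn {V : Set (ℤ × ℤ)} {s₀ : State} (h₀ : s₀.Valid V) :
    Set.InjOn (fun t => (trace V s₀ t).edge) (Set.Iio (period V s₀)) := by
  intro t ht t' ht' h
  exact trace_injOn ht ht' (edge_injOn V (trace_valid h₀ t) (trace_valid h₀ t') h)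

lemma ncard_edgeBoundary {V : Set (ℤ × ℤ)} (hV : IsRegion V) {s₀ : State} (h₀ : s₀.Valid V) :
    (edgeBoundary V).ncard = period V s₀ := by
  rw [edgeBoundary_eq_image hV h₀, Set.InjOn.ncard_image (edge_trace_injOn h₀)]
  simp [Set.ncard_eq_toFinset_card']

/-! ### Half of a boundary cycle -/

/-- A piece of the boundary of `V` that runs from the lower left corner of the leftmost point `(l, 0)`
of the row `0` to the upper right corner of the rightmost point `(r, b)` of the row `b`. -/
structure HalfPath (V : Set (ℤ × ℤ)) (a b l r : ℤ) (s : ℕ → State) (T : ℕ) : Prop where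
  conn : ∀ f : ℤ × ℤ → ℤ, (∀ u ∈ V, ∀ v ∈ V, lattice.Adj u v → f u = f v) →
    ∀ u ∈ V, ∀ v ∈ V, f u = f v
  valid : ∀ t < T, (s t).Valid V
  step : ∀ t < T, (s (t + 1)).tail = (s t).tail + vec (s t).2
  start : (s 0).tail = (l, 0)
  finish : (s T).tail = (r + 1, b + 1)
  ha : 0 ≤ a
  hb : 0 ≤ b
  hl : l ≤ 0
  hr : a ≤ r
  left_mem : (l, 0) ∈ V
  left_out : ∀ c < l, (c, 0) ∉ V
  right_out : ∀ c, r < c → (c, b) ∉ V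
  ne_left : ∀ t < T, s t ≠ ((l, 0), 3)

namespace HalfPath

variable {V : Set (ℤ × ℤ)} {a b l r : ℤ} {s : ℕ → State} {T : ℕ}

/-- The side function of the path extended to infinity: `1` on its left and `0` on its right. -/
def side (b l r : ℤ) (s : ℕ → State) (T : ℕ) (v : ℤ × ℤ) : ℤ :=
  (if v.1 < l ∧ 0 ≤ v.2 then 1 else 0) + (if r < v.1 ∧ b + 1 ≤ v.2 then 1 else 0) + flowSum s T v

/-- The path is extended by a ray from the west between rows -1 and 0 and a ray to the east between
rows `b` and `b + 1`. The two indicators in `side` absorb the `wall` terms at the ends of the path,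
as a horizontal move never crosses these rays. -/
lemma side_sub_east (h : HalfPath V a b l r s T) (c d : ℤ) :
    side b l r s T (c, d) - side b l r s T (c + 1, d) =
      ∑ t ∈ Finset.range T, (s t).cross (c, d) (c + 1, d) := by
  have h1 := flowSum_sub_east h.step c d
  rw [h.start, h.finish] at h1
  unfold side
  unfold wall at h1
  simp only at h1 ⊢
  split_ifs at h1 ⊢ <;> omega

/-- The hypotheses exclude the vertical moves across the two added rays. -/
lemma side_sub_south (c d : ℤ) (h1 : ¬ (c < l ∧ d = 0)) (h2 : ¬ (r < c ∧ d = b + 1)) :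
    side b l r s T (c, d) - side b l r s T (c, d - 1) =
      ∑ t ∈ Finset.range T, (s t).cross (c, d) (c, d - 1) := by
  have h3 := flowSum_sub_south s T c d
  unfold side
  simp only
  split_ifs <;> omega

lemma sum_cross_eq_zero (h : HalfPath V a b l r s T) {u v : ℤ × ℤ} (huv : u ∈ V ↔ v ∈ V) :
    ∑ t ∈ Finset.range T, (s t).cross u v = 0 :=
  Finset.sum_eq_zero fun t ht => State.cross_eq_zero (h.valid t (Finset.mem_range.1 ht)) huv

/-- An edge inside `V` is crossed neither by the path nor by the rays: the west ray passes below (c,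
0) with `c < l`, the east ray above (c, b) with `r < c`, and these points are outside `V`. -/
lemma side_eq_of_adj (h : HalfPath V a b l r s T) :
    ∀ u ∈ V, ∀ v ∈ V, lattice.Adj u v → side b l r s T u = side b l r s T v := by
  have east : ∀ c d, (c, d) ∈ V → (c + 1, d) ∈ V →
      side b l r s T (c, d) = side b l r s T (c + 1, d) := by
    intro c d h1 h2
    have := h.side_sub_east c d
    rw [h.sum_cross_eq_zero (iff_of_true h1 h2)] at this
    omega
  have south : ∀ c d, (c, d) ∈ V → (c, d - 1) ∈ V →
      side b l r s T (c, d) = side b l r s T (c, d - 1) := by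
    intro c d h1 h2
    have := side_sub_south (b := b) (l := l) (r := r) (s := s) (T := T) c d ?_ ?_
    · rw [h.sum_cross_eq_zero (iff_of_true h1 h2)] at this
      omega
    · rintro ⟨h3, rfl⟩
      exact h.left_out c h3 h1
    · rintro ⟨h3, rfl⟩
      rw [add_sub_cancel_right] at h2
      exact h.right_out c h3 h2
  rintro ⟨c, d⟩ hu v hv huv
  obtain ⟨k, rfl⟩ := exists_vec_of_adj huv
  fin_cases k
  · exact east c d hu (by simpa using hv) |>.trans (by simp)
  · have := south c (d + 1) (by simpa using hv) (by simpa using hu)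
    simp at this ⊢; exact this.symm
  · have := east (c - 1) d (by simpa [← sub_eq_add_neg] using hv) (by simpa using hu)
    simp [← sub_eq_add_neg] at this ⊢; exact this.symm
  · have := south c d hu (by simpa [← sub_eq_add_neg] using hv)
    simpa [← sub_eq_add_neg] using this

/-- Far to the west on row 0 only the west ray counts, giving 1. Coming back east along the row, the
only edge the path could cross is the last one, which belongs to the state excluded by `ne_left`. -/
lemma side_left (h : HalfPath V a b l r s T) : side b l r s T (l, 0) = 1 := by
  have h1 : ∀ n : ℕ, side b l r s T (l - n, 0) = side b l r s T (l, 0) := by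
    intro n
    induction n with
    | zero => simp
    | succ n ih =>
      rw [← ih]
      have h2 := h.side_sub_east (l - (n + 1 : ℕ)) 0
      have h3 : l - ((n + 1 : ℕ) : ℤ) + 1 = l - n := by push_cast; ring
      rw [h3] at h2
      have h4 : ∑ t ∈ Finset.range T, (s t).cross (l - ((n + 1 : ℕ) : ℤ), 0) (l - n, 0) = 0 := by
        rcases Nat.eq_zero_or_pos n with rfl | hn
        · refine Finset.sum_eq_zero fun t ht => ?_
          rw [State.cross_swap]
          have hvl : State.Valid V ((l, 0), 3) := by
            refine ⟨h.left_mem, ?_⟩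
            have := h.left_out (l - 1) (by omega)
            simpa [State.out, ← sub_eq_add_neg] using this
          have := State.cross_out (h.valid t (Finset.mem_range.1 ht)) hvl
          rw [if_neg (h.ne_left t (Finset.mem_range.1 ht))] at this
          simpa [State.out, ← sub_eq_add_neg] using this
        · exact h.sum_cross_eq_zero
            (iff_of_false (h.left_out _ (by push_cast; omega)) (h.left_out _ (by omega)))
      omega
  obtain ⟨B, hB⟩ := ((Set.finite_Iio T).image fun t => (s t).tail.1).bddBelow
  have hB' : ∀ t < T, B ≤ (s t).tail.1 := fun t ht => hB ⟨t, ht, rfl⟩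
  set n := (l - B).toNat + 2 with hn
  rw [← h1 n]
  unfold side
  have h2 : flowSum s T (l - n, 0) = 0 := by
    refine Finset.sum_eq_zero fun t ht => ?_
    have := hB' t (Finset.mem_range.1 ht)
    unfold State.flow
    rw [if_neg, if_neg]
    · rintro ⟨-, h3, -⟩; simp only at h3; omega
    · rintro ⟨-, h3, -⟩; simp only at h3; omega
  have := h.hl
  have := h.hr
  have := h.ha
  rw [h2, if_pos, if_neg]
  · simp
  · simp only; omega
  · simp only; omega

lemma side_eq_one (h : HalfPath V a b l r s T) {v : ℤ × ℤ} (hv : v ∈ V) : side b l r s T v = 1 := by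
  rw [h.conn _ h.side_eq_of_adj v hv _ h.left_mem, h.side_left]

/-- A quadrant that the path passes on its upper left side contains no point of `V`. -/
theorem quadrant_disjoint (h : HalfPath V a b l r s T) {i j : ℤ} {t : ℕ} (hi : 0 ≤ i) (hj : j ≤ b)
    (h1 : ∀ t' ≤ t, t' ≤ T → (s t').tail.1 ≤ i) (h2 : ∀ t', t ≤ t' → t' ≤ T → j < (s t').tail.2)
    {v : ℤ × ℤ} (hv : v ∈ V) : ¬ (i ≤ v.1 ∧ v.2 ≤ j) := by
  rintro ⟨h3, h4⟩
  have := h.side_eq_one hv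
  have hl := h.hl
  unfold side at this
  rw [if_neg (by omega), if_neg (by omega)] at this
  -- Before time `t` no step passes beyond column `i`, so none crosses the column of `v`; from time
  -- `t` on the path is above `v`. Thus `v` would be on the right of the path, unlike the points of
  -- `V`.
  have h5 : flowSum s T v = 0 := by
    refine Finset.sum_eq_zero fun t' ht' => ?_
    have ht' := Finset.mem_range.1 ht'
    unfold State.flow
    rcases lt_or_ge t' t with hlt | hge
    · have e1 := h1 t' hlt.le ht'.le
      have e2 := h1 (t' + 1) hlt ht'
      rw [h.step t' ht'] at e2
      rw [if_neg, if_neg]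
      · rintro ⟨-, h6, -⟩; omega
      · rintro ⟨h7, h6, -⟩
        rw [h7] at e2
        simp at e2
        omega
    · have e1 := h2 t' hge ht'.le
      rw [if_neg, if_neg]
      · rintro ⟨-, -, h6⟩; omega
      · rintro ⟨-, -, h6⟩; omega
  omega

end HalfPath

/-! ### Reduced words -/

/-- The running maximum of an integer sequence. -/
def runMax (f : ℕ → ℤ) : ℕ → ℤ
  | 0 => f 0
  | t + 1 => max (runMax f t) (f (t + 1))

lemma runMax_le_iff {f : ℕ → ℤ} {t : ℕ} {x : ℤ} : runMax f t ≤ x ↔ ∀ t' ≤ t, f t' ≤ x := by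
  induction t with
  | zero => simp [runMax]
  | succ t ih =>
    rw [runMax, max_le_iff, ih]
    constructor
    · rintro ⟨h1, h2⟩ t' ht'
      rcases Nat.lt_or_ge t' (t + 1) with h | h
      · exact h1 t' (by omega)
      · rwa [show t' = t + 1 by omega]
    · intro h
      exact ⟨fun t' ht' => h t' (by omega), h _ le_rfl⟩

/-- The headings of the first `T` states of a sequence. -/
def headings (s : ℕ → State) (T : ℕ) : List (Fin 4) := (List.range T).map fun t => (s t).2

lemma headings_succ (s : ℕ → State) (T : ℕ) :
    headings s (T + 1) = headings s T ++ [(s T).2] := by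
  unfold headings; rw [List.range_succ]; simp

lemma length_headings (s : ℕ → State) (T : ℕ) : (headings s T).length = T := by
  simp [headings]

/-- The relation `cuts w i j`: in the word `w`, the `j`-th letter `1` precedes the `i`-th letter `0`
(counting from zero). -/
def cuts (w : List (Fin 4)) (i j : ℕ) : Prop := ∃ q, q <+: w ∧ q.count 0 ≤ i ∧ j < q.count 1

/-- Words with `m` letters `0`, `n` letters `1`, and no other letters. -/
def IsStairWord (m n : ℕ) (w : List (Fin 4)) : Prop :=
  w.count 0 = m ∧ w.count 1 = n ∧ ∀ k ∈ w, k = 0 ∨ k = 1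

/-- The steps kept in the reduced word: eastward steps entering a column for the first time and
northward steps leaving a row for the last time. -/
def Kept (a b : ℤ) (s : ℕ → State) (T t : ℕ) : Prop :=
  ((s t).2 = 0 ∧ 0 ≤ (s t).tail.1 ∧ (s t).tail.1 ≤ a ∧ ∀ t' ≤ t, (s t').tail.1 ≤ (s t).tail.1) ∨
  ((s t).2 = 1 ∧ 0 ≤ (s t).tail.2 ∧ (s t).tail.2 ≤ b ∧
    ∀ t', t < t' → t' ≤ T → (s t).tail.2 < (s t').tail.2)

open Classical in
/-- The reduced word of the first `t` steps. -/
noncomputable def redWord (a b : ℤ) (s : ℕ → State) (T t : ℕ) : List (Fin 4) :=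
  ((List.range t).filter fun t' => decide (Kept a b s T t')).map fun t' => (s t').2

open Classical in
lemma redWord_succ (a b : ℤ) (s : ℕ → State) (T t : ℕ) :
    redWord a b s T (t + 1) = redWord a b s T t ++ if Kept a b s T t then [(s t).2] else [] := by
  unfold redWord
  rw [List.range_succ, List.filter_append, List.map_append]
  congr 1
  by_cases h : Kept a b s T t <;> simp [h]

lemma redWord_sublist (a b : ℤ) (s : ℕ → State) (T t : ℕ) :
    (redWord a b s T t).Sublist (headings s t) :=
  List.Sublist.map _ List.filter_sublist

lemma redWord_letters (a b : ℤ) (s : ℕ → State) (T t : ℕ) :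
    ∀ k ∈ redWord a b s T t, k = 0 ∨ k = 1 := by
  intro k hk
  unfold redWord at hk
  simp only [List.mem_map, List.mem_filter, decide_eq_true_eq] at hk
  obtain ⟨t', ⟨-, h | h⟩, rfl⟩ := hk
  · exact Or.inl h.1
  · exact Or.inr h.1

lemma eq_redWord_of_prefix {a b : ℤ} {s : ℕ → State} {T t : ℕ} {q : List (Fin 4)}
    (h : q <+: redWord a b s T t) : ∃ t' ≤ t, q = redWord a b s T t' := by
  classical
  induction t with
  | zero =>
    refine ⟨0, le_rfl, ?_⟩
    simpa [redWord] using h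
  | succ t ih =>
    rw [redWord_succ] at h
    split_ifs at h with hk
    · rcases List.prefix_concat_iff.1 h with h | h
      · refine ⟨t + 1, le_rfl, ?_⟩
        rw [redWord_succ, if_pos hk, h]
      · obtain ⟨t', ht', rfl⟩ := ih h
        exact ⟨t', by omega, rfl⟩
    · rw [List.append_nil] at h
      obtain ⟨t', ht', rfl⟩ := ih h
      exact ⟨t', by omega, rfl⟩

namespace HalfPath

variable {V : Set (ℤ × ℤ)} {a b l r : ℤ} {s : ℕ → State} {T : ℕ}

/-- Each kept eastward step raises the running maximum of the first coordinate by one, within the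
window from 0 to `a + 1`. -/
lemma count_zero (h : HalfPath V a b l r s T) {t : ℕ} (ht : t ≤ T) :
    ((redWord a b s T t).count 0 : ℤ) = max 0 (min (runMax (fun t => (s t).tail.1) t) (a + 1)) := by
  classical
  have hl := h.hl
  have ha := h.ha
  induction t with
  | zero => simp [redWord, runMax, h.start]; omega
  | succ t ih =>
    have ih := ih (by omega)
    rw [redWord_succ, List.count_append, Nat.cast_add, ih, runMax, h.step t (by omega)]
    have hM : (s t).tail.1 ≤ runMax (fun t => (s t).tail.1) t := runMax_le_iff.1 le_rfl t le_rfl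
    have hK : (∀ t' ≤ t, (s t').tail.1 ≤ (s t).tail.1) ↔
        runMax (fun t => (s t).tail.1) t ≤ (s t).tail.1 := runMax_le_iff.symm
    unfold Kept
    rw [hK]
    generalize runMax (fun t => (s t).tail.1) t = M at *
    generalize (s t).tail = z at *
    generalize (s t).2 = k at *
    fin_cases k
    · simp only [Fin.zero_eta, vec_zero, Prod.fst_add]
      by_cases hc : 0 ≤ z.1 ∧ z.1 ≤ a ∧ M ≤ z.1
      · rw [if_pos (Or.inl ⟨trivial, hc⟩)]
        simp; omega
      · rw [if_neg (by simpa using hc)]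
        simp; omega
    · have : ∀ P : Prop, [Decidable P] → List.count (0 : Fin 4) (if P then [1] else []) = 0 := by
        intro P _; split_ifs <;> simp
      simp [this]; omega
    · simp; omega
    · simp; omega

/-- Each kept northward step raises the minimum of the second coordinate over the remaining times.
This minimum is written as a negated running maximum in reversed time `u = T - t`. -/
lemma count_one (h : HalfPath V a b l r s T) {t : ℕ} (ht : t ≤ T) :
    ((redWord a b s T t).count 1 : ℤ) =
      max 0 (min (- runMax (fun u => - (s (T - u)).tail.2) (T - t)) (b + 1)) := by
  classical
  have hb := h.hb
  induction t with
  | zero =>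
    have : - (s (T - T)).tail.2 ≤ runMax (fun u => - (s (T - u)).tail.2) T :=
      runMax_le_iff.1 le_rfl T le_rfl
    rw [Nat.sub_self, h.start] at this
    simp [redWord] at this ⊢
    omega
  | succ t ih =>
    have ih := ih (by omega)
    obtain ⟨n, rfl⟩ : ∃ n, T = t + 1 + n := ⟨T - (t + 1), by omega⟩
    have e1 : t + 1 + n - t = n + 1 := by omega
    have e2 : t + 1 + n - (t + 1) = n := by omega
    have e3 : t + 1 + n - (n + 1) = t := by omega
    have e4 : t + 1 + n - n = t + 1 := by omega
    rw [e1, runMax, e3] at ih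
    rw [redWord_succ, List.count_append, Nat.cast_add, ih, e2]
    have hM : - (s (t + 1)).tail.2 ≤ runMax (fun u => - (s (t + 1 + n - u)).tail.2) n := by
      have := runMax_le_iff.1 (le_refl (runMax (fun u => - (s (t + 1 + n - u)).tail.2) n)) n le_rfl
      rwa [e4] at this
    rw [h.step t (by omega)] at hM
    have hK : (∀ t', t < t' → t' ≤ t + 1 + n → (s t).tail.2 < (s t').tail.2) ↔
        (s t).tail.2 < - runMax (fun u => - (s (t + 1 + n - u)).tail.2) n := by
      rw [show ∀ x y : ℤ, x < - y ↔ y ≤ - x - 1 from fun x y => by omega, runMax_le_iff]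
      constructor
      · intro h' u hu
        have := h' (t + 1 + n - u) (by omega) (by omega)
        omega
      · intro h' t' h1 h2
        have := h' (t + 1 + n - t') (by omega)
        rw [show t + 1 + n - (t + 1 + n - t') = t' by omega] at this
        omega
    unfold Kept
    rw [hK]
    generalize runMax (fun u => - (s (t + 1 + n - u)).tail.2) n = M at *
    generalize (s t).tail = z at *
    generalize (s t).2 = k at *
    fin_cases k
    · have : ∀ P : Prop, [Decidable P] → List.count (1 : Fin 4) (if P then [0] else []) = 0 := by
        intro P _; split_ifs <;> simp
      simp [this] at hM ⊢; omega
    · simp only [Fin.mk_one, vec_one, Prod.snd_add] at hM ⊢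
      by_cases hc : 0 ≤ z.2 ∧ z.2 ≤ b ∧ z.2 < -M
      · rw [if_pos (Or.inr ⟨trivial, hc⟩)]
        simp; omega
      · rw [if_neg (by simpa using hc)]
        simp; omega
    · simp at hM ⊢; omega
    · simp at hM ⊢; omega

/-- A half path contains a reduced word, whose cut quadrants avoid `V`. -/
theorem exists_word {m n : ℕ} (h : HalfPath V m n l r s T) :
    ∃ w, w.Sublist (headings s T) ∧ IsStairWord (m + 1) (n + 1) w ∧
      ∀ i j : ℕ, i ≤ m → j ≤ n → cuts w i j → ∀ v ∈ V, ¬ ((i : ℤ) ≤ v.1 ∧ v.2 ≤ j) := by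
  have hr := h.hr
  refine ⟨redWord m n s T T, redWord_sublist _ _ _ _ _, ⟨?_, ?_, redWord_letters _ _ _ _ _⟩, ?_⟩
  · have h1 := h.count_zero le_rfl
    have h2 : (s T).tail.1 ≤ runMax (fun t => (s t).tail.1) T := runMax_le_iff.1 le_rfl T le_rfl
    rw [h.finish] at h2
    simp only at h2
    omega
  · have h1 := h.count_one le_rfl
    simp [runMax, h.finish] at h1
    omega
  -- A prefix of the reduced word is the reduced word at some time `t`. Its letter counts say that
  -- the path has not passed `i` by then and remains above `j` afterwards, which is what
  -- `quadrant_disjoint` needs.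
  · rintro i j hi hj ⟨q, hq, hq0, hq1⟩ v hv
    obtain ⟨t, ht, rfl⟩ := eq_redWord_of_prefix hq
    have h1 := h.count_zero ht
    have h2 := h.count_one ht
    refine h.quadrant_disjoint (t := t) (by omega) (by omega) ?_ ?_ hv
    · intro t' ht' _
      exact runMax_le_iff.1 (show runMax (fun t => (s t).tail.1) t ≤ i by omega) t' ht'
    · intro t' ht' ht''
      have := runMax_le_iff.1 (show runMax (fun u => - (s (T - u)).tail.2) (T - t) ≤ - j - 1 by omega)
        (T - t') (by omega)
      rw [show T - (T - t') = t' by omega] at this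
      omega

/-- The path takes at least `r + 1 - l` steps east and `n + 1` steps north. -/
lemma le_count {m n : ℕ} (h : HalfPath V m n l r s T) :
    r + 1 - l ≤ (headings s T).count 0 ∧ (n : ℤ) + 1 ≤ (headings s T).count 1 := by
  have key : ∀ t ≤ T, (s t).tail.1 - l ≤ (headings s t).count 0 ∧
      (s t).tail.2 ≤ (headings s t).count 1 := by
    intro t ht
    induction t with
    | zero => simp [h.start, headings]
    | succ t ih =>
      have ih := ih (by omega)
      rw [headings_succ, h.step t (by omega)]
      generalize (s t).2 = k at *
      fin_cases k <;> simp [List.count_append] <;> omega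
  have := key T le_rfl
  rw [h.finish] at this
  simpa using this

end HalfPath

/-! ### Splitting the boundary cycle -/

/-- The half turn exchanging `0` and `(m, n)`. -/
def turn (m n : ℤ) (v : ℤ × ℤ) : ℤ × ℤ := (m - v.1, n - v.2)

@[simp] lemma turn_turn (m n : ℤ) (v : ℤ × ℤ) : turn m n (turn m n v) = v := by
  ext <;> simp [turn]

lemma turn_add_vec (m n : ℤ) (v : ℤ × ℤ) (k : Fin 4) :
    turn m n (v + vec (k + 2)) = turn m n v + vec k := by
  rw [vec_add_two]; ext <;> simp [turn] <;> ring

/-- The half turn of a state. -/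
def State.turn (m n : ℤ) (s : State) : State := (AnisoPerc.turn m n s.1, s.2 + 2)

lemma fin_four_add_two (k : Fin 4) : k + 2 + 2 = k := by fin_cases k <;> rfl

lemma State.turn_turn (m n : ℤ) (s : State) : (s.turn m n).turn m n = s := by
  obtain ⟨u, k⟩ := s
  simp [State.turn, fin_four_add_two]

lemma State.turn_tail (m n : ℤ) (s : State) :
    (s.turn m n).tail = (m + 1 - s.tail.1, n + 1 - s.tail.2) := by
  obtain ⟨u, k⟩ := s
  fin_cases k <;> ext <;> simp [State.turn, State.tail, AnisoPerc.turn] <;> ring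

lemma State.turn_valid {m n : ℤ} {V : Set (ℤ × ℤ)} {s : State} (h : s.Valid V) :
    (s.turn m n).Valid (AnisoPerc.turn m n ⁻¹' V) := by
  obtain ⟨h1, h2⟩ := h
  refine ⟨by simpa [State.turn] using h1, ?_⟩
  have h3 : s.2 + 2 + 3 = s.2 + 3 + 2 := by rw [add_assoc, add_assoc]; rfl
  have : (s.turn m n).out = AnisoPerc.turn m n s.out := by
    unfold State.out State.turn
    have h4 := turn_add_vec m n s.1 (s.2 + 3 + 2)
    rw [fin_four_add_two] at h4
    simp only [h3]
    exact h4.symm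
  rw [this]
  simpa using h2

lemma turn_adj {m n : ℤ} {u v : ℤ × ℤ} (h : lattice.Adj u v) :
    lattice.Adj (turn m n u) (turn m n v) := by
  rw [lattice_adj_iff] at h ⊢
  simp only [turn]
  rw [← h]
  congr 1
  · rw [show m - u.1 - (m - v.1) = - (u.1 - v.1) by ring, abs_neg]
  · rw [show n - u.2 - (n - v.2) = - (u.2 - v.2) by ring, abs_neg]

lemma HalfPath.conn_turn {V : Set (ℤ × ℤ)} (hV : IsRegion V) (m n : ℤ) (f : ℤ × ℤ → ℤ)
    (hf : ∀ u ∈ turn m n ⁻¹' V, ∀ v ∈ turn m n ⁻¹' V, lattice.Adj u v → f u = f v) :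
    ∀ u ∈ turn m n ⁻¹' V, ∀ v ∈ turn m n ⁻¹' V, f u = f v := by
  intro u hu v hv
  have := hV.const (fun w => f (turn m n w)) (fun u hu v hv huv =>
    hf _ (by simpa using hu) _ (by simpa using hv) (turn_adj huv)) _ hu _ hv
  simpa using this

lemma exists_leftmost {V : Set (ℤ × ℤ)} (hV : V.Finite) {a b : ℤ} (h : (a, b) ∈ V) :
    ∃ l ≤ a, (l, b) ∈ V ∧ ∀ c < l, (c, b) ∉ V := by
  obtain ⟨v, ⟨hv, hv2⟩, hmin⟩ := Set.exists_min_image (V ∩ {v | v.2 = b}) (fun v => v.1)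
    (hV.subset Set.inter_subset_left) ⟨(a, b), h, rfl⟩
  obtain ⟨l, b'⟩ := v
  obtain rfl : b' = b := hv2
  refine ⟨l, hmin _ ⟨h, rfl⟩, hv, fun c hc hcV => ?_⟩
  have := hmin _ ⟨hcV, rfl⟩
  simp only at this
  omega

lemma exists_rightmost {V : Set (ℤ × ℤ)} (hV : V.Finite) {a b : ℤ} (h : (a, b) ∈ V) :
    ∃ r, a ≤ r ∧ (r, b) ∈ V ∧ ∀ c, r < c → (c, b) ∉ V := by
  obtain ⟨v, ⟨hv, hv2⟩, hmax⟩ := Set.exists_max_image (V ∩ {v | v.2 = b}) (fun v => v.1)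
    (hV.subset Set.inter_subset_left) ⟨(a, b), h, rfl⟩
  obtain ⟨r, b'⟩ := v
  obtain rfl : b' = b := hv2
  refine ⟨r, hmax _ ⟨h, rfl⟩, hv, fun c hc hcV => ?_⟩
  have := hmax _ ⟨hcV, rfl⟩
  simp only at this
  omega

/-- The boundary trace of `V` from the left end of row `0`, passing the right end of row `n` at time
`τ`. -/
structure Split (V : Set (ℤ × ℤ)) (m n : ℕ) (l r : ℤ) (τ : ℕ) : Prop where
  valid : State.Valid V ((l, 0), 3)
  lt : τ < period V ((l, 0), 3)
  trace_eq : trace V ((l, 0), 3) τ = ((r, (n : ℤ)), 1)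
  fst : HalfPath V m n l r (fun t => trace V ((l, 0), 3) (1 + t)) τ
  snd : HalfPath (turn m n ⁻¹' V) m n (m - r) (m - l)
    (fun t => (trace V ((l, 0), 3) (τ + 1 + t)).turn m n) (period V ((l, 0), 3) - τ)

theorem exists_split {V : Set (ℤ × ℤ)} (hV : IsRegion V) {m n : ℕ} (h0 : (0, 0) ∈ V)
    (hx : ((m : ℤ), (n : ℤ)) ∈ V) : ∃ l r τ, Split V m n l r τ := by
  obtain ⟨l, hl, hlV, hlout⟩ := exists_leftmost hV.finite h0
  obtain ⟨r, hr, hrV, hrout⟩ := exists_rightmost hV.finite hx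
  have hv₀ : State.Valid V ((l, 0), 3) := by
    refine ⟨hlV, ?_⟩
    have := hlout (l - 1) (by omega)
    simpa [State.out, ← sub_eq_add_neg] using this
  have hv₁ : State.Valid V ((r, (n : ℤ)), 1) := by
    refine ⟨hrV, ?_⟩
    have := hrout (r + 1) (by omega)
    simpa [State.out] using this
  obtain ⟨τ, hτ, hτeq⟩ := exists_trace_eq hV hv₀ hv₁
  have hτ0 : τ ≠ 0 := by
    rintro rfl
    rw [trace_zero, Prod.mk.injEq] at hτeq
    exact absurd hτeq.2 (by decide)
  set L := period V ((l, 0), 3) with hL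
  refine ⟨l, r, τ, hv₀, hτ, hτeq, ?_, ?_⟩
  -- The shift by 1 skips the initial southward step beside (l, 0), which recurs only after a full
  -- period and so belongs to the second half. In the same way the second half skips the step at
  -- time `τ`.
  · refine ⟨hV.const, fun t _ => trace_valid hv₀ _, fun t _ => trace_tail _ _ (1 + t), ?_, ?_,
      by omega, by omega, hl, hr, hlV, hlout, hrout, ?_⟩
    · change (trace V ((l, 0), 3) (0 + 1)).tail = _
      rw [trace_tail, trace_zero]
      simp [State.tail]
    · rw [add_comm, trace_tail, hτeq]
      simp [State.tail]
    · intro t ht heq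
      have := trace_injOn (s₀ := ((l, 0), 3)) (V := V) (show 1 + t < L by omega)
        (show 0 < L by omega) (by rw [heq, trace_zero])
      omega
  · refine ⟨HalfPath.conn_turn hV m n, fun t _ => State.turn_valid (trace_valid hv₀ _), ?_, ?_, ?_,
      by omega, by omega, by omega, by omega, ?_, ?_, ?_, ?_⟩
    · intro t _
      change ((trace V ((l, 0), 3) (τ + 1 + t + 1)).turn m n).tail = _
      rw [State.turn_tail, State.turn_tail, trace_tail]
      simp only [State.turn, vec_add_two]
      ext <;> simp <;> ring
    · change ((trace V ((l, 0), 3) (τ + 1)).turn m n).tail = _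
      rw [State.turn_tail, trace_tail, hτeq]
      simp [State.tail]
    · rw [show τ + 1 + (L - τ) = L + 1 by omega, State.turn_tail, trace_tail, trace_period]
      simp [State.tail]; ring
    · simp [turn, hrV]
    · intro c hc hcV
      simp only [turn, Set.mem_preimage, sub_zero] at hcV
      exact hrout _ (by omega) hcV
    · intro c hc hcV
      simp only [turn, Set.mem_preimage, sub_self] at hcV
      exact hlout _ (by omega) hcV
    · intro t ht heq
      have h1 : trace V ((l, 0), 3) (τ + 1 + t) = trace V ((l, 0), 3) τ := by
        rw [hτeq, ← State.turn_turn m n (trace V ((l, 0), 3) (τ + 1 + t)), heq]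
        simp [State.turn, turn]
      rcases Nat.lt_or_ge (τ + 1 + t) L with h2 | h2
      · have := trace_injOn (s₀ := ((l, 0), 3)) (V := V) h2 hτ h1
        omega
      · rw [show τ + 1 + t = L by omega, trace_period] at h1
        have := trace_injOn (s₀ := ((l, 0), 3)) (V := V) (show 0 < L by omega) hτ
          (by rw [← h1, trace_zero])
        omega

namespace Split

variable {V : Set (ℤ × ℤ)} {m n : ℕ} {l r : ℤ} {τ : ℕ}

/-- The word of the headings of the boundary cycle. -/
noncomputable def word (V : Set (ℤ × ℤ)) (l : ℤ) : List (Fin 4) :=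
  headings (fun t => trace V ((l, 0), 3) (1 + t)) (period V ((l, 0), 3))

lemma length_word : (word V l).length = period V ((l, 0), 3) := length_headings _ _

lemma word_eq (h : Split V m n l r τ) :
    word V l = headings (fun t => trace V ((l, 0), 3) (1 + t)) τ ++
      (headings (fun t => (trace V ((l, 0), 3) (τ + 1 + t)).turn m n)
        (period V ((l, 0), 3) - τ)).map (· + 2) := by
  have hlt := h.lt
  unfold word
  obtain ⟨d, hd⟩ : ∃ d, period V ((l, 0), 3) = τ + d := ⟨_, (Nat.add_sub_of_le hlt.le).symm⟩
  rw [hd, Nat.add_sub_cancel_left]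
  unfold headings
  rw [List.range_add, List.map_append, List.map_map, List.map_map]
  congr 1
  refine List.map_congr_left fun t _ => ?_
  simp only [Function.comp, State.turn, fin_four_add_two]
  congr 2; omega

lemma count_map_add_two (w : List (Fin 4)) (k : Fin 4) :
    (w.map (· + 2)).count (k + 2) = w.count k :=
  List.count_map_of_injective _ _ (add_left_injective 2) _

/-- Every boundary word contains enough steps in each of the four directions. -/
lemma le_count (h : Split V m n l r τ) :
    r + 1 - l ≤ (word V l).count 0 ∧ (n : ℤ) + 1 ≤ (word V l).count 1 ∧
    r + 1 - l ≤ (word V l).count 2 ∧ (n : ℤ) + 1 ≤ (word V l).count 3 := by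
  have h1 := h.fst.le_count
  have h2 := h.snd.le_count
  have h3 := count_map_add_two (headings (fun t => (trace V ((l, 0), 3) (τ + 1 + t)).turn m n)
        (period V ((l, 0), 3) - τ))
  have h4 := h3 0
  have h5 := h3 1
  rw [h.word_eq]
  simp only [List.count_append]
  rw [show (0 : Fin 4) + 2 = 2 from rfl] at h4
  rw [show (1 : Fin 4) + 2 = 3 from rfl] at h5
  rw [h4, h5]
  omega

lemma length_eq_count (w : List (Fin 4)) :
    w.length = w.count 0 + w.count 1 + w.count 2 + w.count 3 := by
  induction w with
  | nil => rfl
  | cons k w ih => fin_cases k <;> simp [ih] <;> omega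

end Split

/-! ### Admissible pairs of words and minimal contours -/

lemma cuts.mono {w : List (Fin 4)} {i j i' j' : ℕ} (h : cuts w i j) (hi : i ≤ i') (hj : j' ≤ j) :
    cuts w i' j' := by
  obtain ⟨q, h1, h2, h3⟩ := h
  exact ⟨q, h1, h2.trans hi, hj.trans_lt h3⟩

lemma not_cuts_append_zero (q v : List (Fin 4)) :
    ¬ cuts (q ++ 0 :: v) (q.count 0) (q.count 1) := by
  rintro ⟨p, h1, h2, h3⟩
  have hq : q ++ [0] <+: q ++ 0 :: v := ⟨v, by simp⟩
  rcases List.prefix_or_prefix_of_prefix h1 hq with h | h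
  · rcases List.prefix_concat_iff.1 h with h | h
    · rw [h] at h2; simp at h2
    · exact absurd (h.sublist.count_le 1) (by omega)
  · have := h.sublist.count_le 0
    simp at this; omega

lemma cuts_append_one (q v : List (Fin 4)) : cuts (q ++ 1 :: v) (q.count 0) (q.count 1) :=
  ⟨q ++ [1], ⟨v, by simp⟩, by simp, by simp⟩

/-- At a first disagreement after a common prefix `q`, the word continuing with `1` cuts at the
letter counts of `q` and the word continuing with `0` does not. -/
lemma eq_of_cuts_iff {m n : ℕ} {w w' : List (Fin 4)} (h : IsStairWord (m + 1) (n + 1) w)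
    (h' : IsStairWord (m + 1) (n + 1) w')
    (hc : ∀ i j, i ≤ m → j ≤ n → (cuts w i j ↔ cuts w' i j)) : w = w' := by
  have hlen : ∀ w : List (Fin 4), (∀ k ∈ w, k = 0 ∨ k = 1) → w.length = w.count 0 + w.count 1 := by
    intro w hw
    rw [Split.length_eq_count, List.count_eq_zero_of_not_mem (a := (2 : Fin 4)),
      List.count_eq_zero_of_not_mem (a := (3 : Fin 4))]
    · rfl
    · intro h; simpa using hw _ h
    · intro h; simpa using hw _ h
  have key : ∀ u u' q : List (Fin 4), w = q ++ u → w' = q ++ u' → u = u' := by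
    intro u
    induction u with
    | nil =>
      intro u' q e e'
      have h1 := hlen w h.2.2
      have h2 := hlen w' h'.2.2
      rw [h.1, h.2.1, e] at h1
      rw [h'.1, h'.2.1, e'] at h2
      simp at h1 h2
      exact (List.length_eq_zero_iff.1 (by omega)).symm
    | cons k v ih =>
      intro u' q e e'
      cases u' with
      | nil =>
        have h1 := hlen w h.2.2
        have h2 := hlen w' h'.2.2
        rw [h.1, h.2.1, e] at h1
        rw [h'.1, h'.2.1, e'] at h2
        simp at h1 h2
        omega
      | cons k' v' =>
        have hk := h.2.2 k (by rw [e]; simp)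
        have hk' := h'.2.2 k' (by rw [e']; simp)
        have c0 := h.1
        have c1 := h.2.1
        have c0' := h'.1
        have c1' := h'.2.1
        rcases hk with rfl | rfl <;> rcases hk' with rfl | rfl
        · rw [ih v' (q ++ [0]) (by simp [e]) (by simp [e'])]
        · exfalso
          rw [e] at c0
          rw [e'] at c1'
          simp at c0 c1'
          have := hc (q.count 0) (q.count 1) (by omega) (by omega)
          rw [e, e'] at this
          exact not_cuts_append_zero q v (this.2 (cuts_append_one q v'))
        · exfalso
          rw [e] at c1
          rw [e'] at c0'
          simp at c0' c1
          have := hc (q.count 0) (q.count 1) (by omega) (by omega)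
          rw [e, e'] at this
          exact not_cuts_append_zero q v' (this.1 (cuts_append_one q v))
        · rw [ih v' (q ++ [1]) (by simp [e]) (by simp [e'])]
  exact key w w' [] rfl rfl

/-- Pairs of words bounding a staircase region of the box `[0, m] × [0, n]`. -/
structure Admissible (m n : ℕ) (p : List (Fin 4) × List (Fin 4)) : Prop where
  fst : IsStairWord (m + 1) (n + 1) p.1
  snd : IsStairWord (m + 1) (n + 1) p.2
  fst_zero : ¬ cuts p.1 0 0
  fst_top : ¬ cuts p.1 m n
  snd_zero : ¬ cuts p.2 0 0
  snd_top : ¬ cuts p.2 m n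
  link : ∀ i < m, ∃ j ≤ n, ¬ cuts p.2 (m - i) (n - j) ∧ ¬ cuts p.1 (i + 1) j

/-- The boundary word of the staircase region of an admissible pair. -/
def pairWord (p : List (Fin 4) × List (Fin 4)) : List (Fin 4) := p.1 ++ p.2.map (· + 2)

/-- Otherwise the indicator of the half-plane up to column `i` would be constant on the connected
set `V`. -/
lemma exists_crossing {V : Set (ℤ × ℤ)} (hV : IsRegion V) {u v : ℤ × ℤ} (hu : u ∈ V) (hv : v ∈ V)
    {i : ℤ} (h1 : u.1 ≤ i) (h2 : i < v.1) : ∃ y, (i, y) ∈ V ∧ (i + 1, y) ∈ V := by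
  by_contra hcon
  push Not at hcon
  have := hV.const (fun w => if w.1 ≤ i then 1 else 0) ?_ u hu v hv
  · simp [h1, h2] at this
  · rintro ⟨a, b⟩ ha v' hb hadj
    obtain ⟨k, rfl⟩ := exists_vec_of_adj hadj
    fin_cases k
    · by_cases hai : a = i
      · subst hai
        exact absurd (by simpa using hb) (hcon b ha)
      · simp only [Fin.zero_eta, vec_zero, Prod.fst_add]; split_ifs <;> omega
    · simp
    · by_cases hai : a = i + 1
      · subst hai
        exact absurd ha (hcon b (by simpa using hb))
      · simp only [Fin.reduceFinMk, vec_two, Prod.fst_add]; split_ifs <;> omega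
    · simp

/-- The boundary word of a region contains the boundary word of a staircase region. -/
theorem exists_admissible {V : Set (ℤ × ℤ)} (hV : IsRegion V) {m n : ℕ} (h0 : (0, 0) ∈ V)
    (hx : ((m : ℤ), (n : ℤ)) ∈ V) {l r : ℤ} {τ : ℕ} (h : Split V m n l r τ) :
    ∃ p, Admissible m n p ∧ (pairWord p).Sublist (Split.word V l) := by
  obtain ⟨w₁, hs₁, hw₁, hc₁⟩ := h.fst.exists_word
  obtain ⟨w₂, hs₂, hw₂, hc₂'⟩ := h.snd.exists_word
  have hc₂ : ∀ i j : ℕ, i ≤ m → j ≤ n → cuts w₂ (m - i) (n - j) →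
      ∀ v ∈ V, ¬ (v.1 ≤ i ∧ (j : ℤ) ≤ v.2) := by
    rintro i j hi hj hc v hv ⟨h1, h2⟩
    refine hc₂' _ _ (Nat.sub_le _ _) (Nat.sub_le _ _) hc (turn m n v) (by simpa using hv) ?_
    simp only [turn]
    omega
  have top₁ : ¬ cuts w₁ m n := fun hc => hc₁ m n le_rfl le_rfl hc _ hx ⟨le_rfl, le_rfl⟩
  have top₂ : ¬ cuts w₂ m n := fun hc =>
    hc₂ 0 0 (Nat.zero_le _) (Nat.zero_le _) (by simpa using hc) _ h0 (by simp)
  refine ⟨(w₁, w₂), ⟨hw₁, hw₂, ?_, top₁, ?_, top₂, ?_⟩, ?_⟩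
  · intro hc
    exact hc₁ 0 0 (Nat.zero_le _) (Nat.zero_le _) hc _ h0 (by simp)
  · intro hc
    exact hc₂ m n le_rfl le_rfl (by simpa using hc) _ hx ⟨le_rfl, le_rfl⟩
  · intro i hi
    by_contra hcon
    push Not at hcon
    -- `V` contains an edge joining columns `i` and `i + 1`. If every row were cut by one of the two
    -- words, an end of this edge would lie in a forbidden quadrant; heights outside [0, n] are
    -- handled by the cuts at rows 0 and `n`.
    obtain ⟨y, hy1, hy2⟩ := exists_crossing hV h0 hx (i := i) (by simp) (by simpa using hi)
    simp only at hcon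
    have hlow : cuts w₁ (i + 1) 0 := by
      refine hcon 0 (Nat.zero_le _) fun hc => ?_
      exact hc₂ i 0 hi.le (Nat.zero_le _) hc _ h0 (by simp)
    have hhigh : cuts w₂ (m - i) (n - n) := by
      by_contra hc
      have := hcon n le_rfl hc
      exact hc₁ (i + 1) n hi le_rfl this _ hx (by simpa using hi)
    rcases lt_or_ge y 0 with hneg | hnn
    · exact hc₁ (i + 1) 0 hi (Nat.zero_le _) hlow _ hy2 (by simp; omega)
    rcases lt_or_ge (n : ℤ) y with hgt | hle
    · exact hc₂ i n hi.le le_rfl hhigh _ hy1 (by simp; omega)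
    lift y to ℕ using hnn
    by_cases hc : cuts w₂ (m - i) (n - y)
    · exact hc₂ i y hi.le (by omega) hc _ hy1 (by simp)
    · exact hc₁ (i + 1) y hi (by omega) (hcon y (by omega) hc) _ hy2 (by simp)
  · rw [h.word_eq]
    exact hs₁.append (hs₂.map _)

/-- The staircase region of a pair of words, reflected in the diagonal. -/
def stair (m n : ℕ) (p : List (Fin 4) × List (Fin 4)) : Set (ℤ × ℤ) :=
  {v | ∃ i j : ℕ, i ≤ m ∧ j ≤ n ∧ v = ((j : ℤ), (i : ℤ)) ∧ ¬ cuts p.1 i j ∧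
    ¬ cuts p.2 (m - i) (n - j)}

lemma mem_stair {m n : ℕ} {p : List (Fin 4) × List (Fin 4)} {i j : ℕ} :
    ((j : ℤ), (i : ℤ)) ∈ stair m n p ↔ i ≤ m ∧ j ≤ n ∧ ¬ cuts p.1 i j ∧
      ¬ cuts p.2 (m - i) (n - j) := by
  constructor
  · rintro ⟨i', j', h1, h2, h3, h4⟩
    rw [Prod.mk.injEq, Nat.cast_inj, Nat.cast_inj] at h3
    obtain ⟨rfl, rfl⟩ := h3
    exact ⟨h1, h2, h4⟩
  · rintro ⟨h1, h2, h3⟩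
    exact ⟨i, j, h1, h2, rfl, h3⟩

/-- Within a row, a cut by the first word spreads to the west and one by the second word to the
east, so a gap would remove an end point. -/
lemma stair_fst_convex {m n : ℕ} {p : List (Fin 4) × List (Fin 4)} {a b c d : ℤ}
    (h1 : (a, d) ∈ stair m n p) (h2 : (c, d) ∈ stair m n p) (hab : a ≤ b) (hbc : b ≤ c) :
    (b, d) ∈ stair m n p := by
  obtain ⟨i, j, hi, hj, e, hc1, hc2⟩ := h1
  obtain ⟨i', j', hi', hj', e', hc1', hc2'⟩ := h2
  rw [Prod.mk.injEq] at e e'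
  obtain ⟨rfl, rfl⟩ := e
  obtain ⟨rfl, e⟩ := e'
  obtain rfl : i = i' := by exact_mod_cast e
  lift b to ℕ using (by omega)
  rw [mem_stair]
  exact ⟨hi, by omega, fun h => hc1 (h.mono le_rfl (by omega)),
    fun h => hc2' (h.mono le_rfl (by omega))⟩

lemma stair_snd_convex {m n : ℕ} {p : List (Fin 4) × List (Fin 4)} {a b c d : ℤ}
    (h1 : (d, a) ∈ stair m n p) (h2 : (d, c) ∈ stair m n p) (hab : a ≤ b) (hbc : b ≤ c) :
    (d, b) ∈ stair m n p := by
  obtain ⟨i, j, hi, hj, e, hc1, hc2⟩ := h1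
  obtain ⟨i', j', hi', hj', e', hc1', hc2'⟩ := h2
  rw [Prod.mk.injEq] at e e'
  obtain ⟨rfl, rfl⟩ := e
  obtain ⟨e, rfl⟩ := e'
  obtain rfl : j = j' := by exact_mod_cast e
  lift b to ℕ using (by omega)
  rw [mem_stair]
  exact ⟨by omega, hj, fun h => hc1' (h.mono (by omega) le_rfl),
    fun h => hc2 (h.mono (by omega) le_rfl)⟩

namespace Admissible

variable {m n : ℕ} {p : List (Fin 4) × List (Fin 4)}

lemma link_mem (h : Admissible m n p) {i : ℕ} (hi : i < m) :
    ∃ j : ℕ, ((j : ℤ), (i : ℤ)) ∈ stair m n p ∧ ((j : ℤ), ((i + 1 : ℕ) : ℤ)) ∈ stair m n p := by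
  obtain ⟨j, hj, h1, h2⟩ := h.link i hi
  refine ⟨j, ?_, ?_⟩
  · rw [mem_stair]
    exact ⟨hi.le, hj, fun hc => h2 (hc.mono (Nat.le_succ i) le_rfl), h1⟩
  · rw [mem_stair]
    exact ⟨hi, hj, h2, fun hc => h1 (hc.mono (by omega) le_rfl)⟩

lemma zero_mem (h : Admissible m n p) : (0, 0) ∈ stair m n p := by
  have := (mem_stair (m := m) (n := n) (p := p) (i := 0) (j := 0)).2
    ⟨Nat.zero_le _, Nat.zero_le _, h.fst_zero, by simpa using h.snd_top⟩
  simpa using this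

lemma top_mem (h : Admissible m n p) : ((n : ℤ), (m : ℤ)) ∈ stair m n p :=
  mem_stair.2 ⟨le_rfl, le_rfl, h.fst_top, by simpa using h.snd_zero⟩

lemma exists_mem_row (h : Admissible m n p) {i : ℕ} (hi : i ≤ m) :
    ∃ j : ℕ, ((j : ℤ), (i : ℤ)) ∈ stair m n p := by
  rcases hi.lt_or_eq with h' | rfl
  · obtain ⟨j, hj, -⟩ := h.link_mem h'
    exact ⟨j, hj⟩
  · exact ⟨n, h.top_mem⟩

lemma reachable_row {a c d : ℤ} (h1 : (a, d) ∈ stair m n p) (h2 : (c, d) ∈ stair m n p)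
    (hac : a ≤ c) : (cutGraph (stair m n p)).Reachable (a, d) (c, d) := by
  obtain ⟨k, rfl⟩ : ∃ k : ℕ, c = a + k := ⟨(c - a).toNat, by omega⟩
  clear hac
  induction k with
  | zero => simp
  | succ k ih =>
    have h3 : (a + k, d) ∈ stair m n p := stair_fst_convex h1 h2 (by omega) (by push_cast; omega)
    refine (ih h3).trans (SimpleGraph.Adj.reachable (cutGraph_adj.2 ⟨?_, iff_of_true h3 h2⟩))
    have := adj_add_vec (a + k, d) 0
    simpa [add_assoc] using this

/-- Rows are intervals and `link` joins consecutive rows, which gives connectedness. There are no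
holes: a point of the box removed by the first word escapes north, one removed by the second word
escapes south, and points outside the box escape directly. -/
theorem isRegion (h : Admissible m n p) : IsRegion (stair m n p) := by
  have hrow : ∀ a c d, (a, d) ∈ stair m n p → (c, d) ∈ stair m n p →
      (cutGraph (stair m n p)).Reachable (a, d) (c, d) := by
    intro a c d h1 h2
    rcases le_total a c with hac | hac
    · exact reachable_row h1 h2 hac
    · exact (reachable_row h2 h1 hac).symm
  have hreach : ∀ i : ℕ, ∀ j : ℤ, (j, (i : ℤ)) ∈ stair m n p →
      (cutGraph (stair m n p)).Reachable (0, 0) (j, (i : ℤ)) := by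
    intro i
    induction i with
    | zero => intro j hj; exact hrow _ _ _ h.zero_mem hj
    | succ i ih =>
      intro j hj
      have hi : i + 1 ≤ m := by
        obtain ⟨i', j', h1, -, h2, -⟩ := hj
        rw [Prod.mk.injEq] at h2
        omega
      obtain ⟨j', h1, h2⟩ := h.link_mem hi
      refine ((ih j' h1).trans (SimpleGraph.Adj.reachable
        (cutGraph_adj.2 ⟨?_, iff_of_true h1 h2⟩))).trans (hrow _ _ _ h2 hj)
      have := adj_add_vec ((j' : ℤ), (i : ℤ)) 1
      simpa using this
  refine ⟨?_, ⟨_, h.zero_mem⟩, ?_, ?_⟩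
  · refine ((Set.finite_Icc (0 : ℤ) n).prod (Set.finite_Icc (0 : ℤ) m)).subset ?_
    rintro _ ⟨i, j, hi, hj, rfl, -⟩
    simp [hi, hj]
  · rintro ⟨a, b⟩ hu ⟨c, d⟩ hv
    have aux : ∀ v ∈ stair m n p, (cutGraph (stair m n p)).Reachable (0, 0) v := by
      intro v hv
      have hv' := hv
      obtain ⟨i, j, -, -, rfl, -⟩ := hv'
      exact hreach i j hv
    exact (aux _ hu).symm.trans (aux _ hv)
  · rintro ⟨a, b⟩ hv
    by_cases h1 : a < 0
    · refine infinite_of_ray (k := 2) fun t => ?_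
      rintro ⟨i, j, -, -, e, -⟩
      simp at e; omega
    by_cases h2 : b < 0
    · refine infinite_of_ray (k := 3) fun t => ?_
      rintro ⟨i, j, -, -, e, -⟩
      simp at e; omega
    by_cases h3 : n < a
    · refine infinite_of_ray (k := 0) fun t => ?_
      rintro ⟨i, j, -, hj, e, -⟩
      simp at e; omega
    by_cases h4 : m < b
    · refine infinite_of_ray (k := 1) fun t => ?_
      rintro ⟨i, j, hi, -, e, -⟩
      simp at e; omega
    lift a to ℕ using (by omega)
    lift b to ℕ using (by omega)
    rw [mem_stair] at hv
    by_cases hc : cuts p.1 b a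
    · refine infinite_of_ray (k := 1) fun t => ?_
      have : ((a : ℤ), (b : ℤ)) + t • vec 1 = ((a : ℤ), ((b + t : ℕ) : ℤ)) := by simp
      rw [this, mem_stair]
      exact fun h' => h'.2.2.1 (hc.mono (by omega) le_rfl)
    · have hc2 : cuts p.2 (m - b) (n - a) := by
        by_contra hc2
        exact hv ⟨by omega, by omega, hc, hc2⟩
      refine infinite_of_ray (k := 3) fun t => ?_
      rintro ⟨i, j, hi, hj, e, h5, h6⟩
      simp at e
      obtain rfl : a = j := e.1
      exact h6 (hc2.mono (by omega) le_rfl)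

/-- Every row meets the staircase, so a missing point of the box is cut by the first word when the
staircase continues to its east, and by the second when it continues to its west. The set thus
determines all cuts, hence both words. -/
theorem injective {p' : List (Fin 4) × List (Fin 4)} (h : Admissible m n p)
    (h' : Admissible m n p') (heq : stair m n p = stair m n p') : p = p' := by
  have key₁ : ∀ q, Admissible m n q → ∀ i j : ℕ, i ≤ m → j ≤ n → (cuts q.1 i j ↔
      ((j : ℤ), (i : ℤ)) ∉ stair m n q ∧ ∃ j' : ℕ, j < j' ∧ ((j' : ℤ), (i : ℤ)) ∈ stair m n q) := by
    intro q hq i j hi hj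
    constructor
    · intro hc
      refine ⟨fun hm => (mem_stair.1 hm).2.2.1 hc, ?_⟩
      obtain ⟨j', hj'⟩ := hq.exists_mem_row hi
      refine ⟨j', ?_, hj'⟩
      by_contra hlt
      exact (mem_stair.1 hj').2.2.1 (hc.mono le_rfl (by omega))
    · rintro ⟨h1, j', h2, h3⟩
      by_contra hc
      rw [mem_stair] at h1 h3
      exact h1 ⟨hi, hj, hc, fun hc2 => h3.2.2.2 (hc2.mono le_rfl (by omega))⟩
  have key₂ : ∀ q, Admissible m n q → ∀ i j : ℕ, i ≤ m → j ≤ n → (cuts q.2 (m - i) (n - j) ↔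
      ((j : ℤ), (i : ℤ)) ∉ stair m n q ∧ ∃ j' : ℕ, j' < j ∧ ((j' : ℤ), (i : ℤ)) ∈ stair m n q) := by
    intro q hq i j hi hj
    constructor
    · intro hc
      refine ⟨fun hm => (mem_stair.1 hm).2.2.2 hc, ?_⟩
      obtain ⟨j', hj'⟩ := hq.exists_mem_row hi
      refine ⟨j', ?_, hj'⟩
      by_contra hlt
      exact (mem_stair.1 hj').2.2.2 (hc.mono le_rfl (by omega))
    · rintro ⟨h1, j', h2, h3⟩
      by_contra hc
      rw [mem_stair] at h1 h3
      exact h1 ⟨hi, hj, fun hc2 => h3.2.2.1 (hc2.mono le_rfl (by omega)), hc⟩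
  refine Prod.ext (eq_of_cuts_iff h.fst h'.fst fun i j hi hj => ?_)
    (eq_of_cuts_iff h.snd h'.snd fun i j hi hj => ?_)
  · rw [key₁ p h i j hi hj, key₁ p' h' i j hi hj, heq]
  · have e1 : m - (m - i) = i := by omega
    have e2 : n - (n - j) = j := by omega
    have := (key₂ p h (m - i) (n - j) (by omega) (by omega)).trans
      ((by rw [heq] : _ ↔ _).trans (key₂ p' h' (m - i) (n - j) (by omega) (by omega)).symm)
    rwa [e1, e2] at this

end Admissible

/-! ### Staircase regions give minimal contours -/

lemma ncard_edgeBoundary_stair_le (m n : ℕ) (p : List (Fin 4) × List (Fin 4)) :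
    (edgeBoundary (stair m n p)).ncard ≤ 2 * (m + 1) + 2 * (n + 1) := by
  set U := stair m n p
  set T : Finset (Fin 4 × ℕ) := ({1, 3} : Finset (Fin 4)) ×ˢ Finset.range (m + 1) ∪
    ({0, 2} : Finset (Fin 4)) ×ˢ Finset.range (n + 1) with hT
  have hcard : T.card ≤ 2 * (m + 1) + 2 * (n + 1) := by
    refine (Finset.card_union_le _ _).trans ?_
    simp
  have himg : edgeBoundary U = State.edge '' {s | s.Valid U} := by
    ext e
    constructor
    · intro he
      obtain ⟨s, hs, rfl⟩ := exists_valid_of_mem_edgeBoundary he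
      exact ⟨s, hs, rfl⟩
    · rintro ⟨s, hs, rfl⟩
      exact hs.edge_mem
  rw [himg, Set.InjOn.ncard_image (edge_injOn U)]
  refine le_trans ?_ hcard
  rw [← Set.ncard_coe_finset]
  -- Each heading occurs at most once per line: rows for headings `1` and `3`, columns for `0` and
  -- `2`. Two parallel sides facing the same way on one line would contradict convexity.
  refine Set.ncard_le_ncard_of_injOn
    (fun s : State => (s.2, (if s.2 = 1 ∨ s.2 = 3 then s.1.2 else s.1.1).toNat)) ?_ ?_
    (Finset.finite_toSet _)
  · rintro ⟨u, k⟩ ⟨⟨i, j, hi, hj, hu, -⟩, -⟩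
    simp only at hu
    subst hu
    fin_cases k <;> simp [hT] <;> omega
  · rintro ⟨u, k⟩ ⟨hu, hu'⟩ ⟨w, k'⟩ ⟨hw, hw'⟩ h
    simp only [Prod.mk.injEq] at h
    obtain ⟨rfl, h⟩ := h
    obtain ⟨i, j, hi, hj, rfl, -⟩ := id hu
    obtain ⟨i', j', hi', hj', rfl, -⟩ := id hw
    simp only at hu hw
    fin_cases k <;> simp [State.out] at h hu' hw' <;> subst h <;> simp only [Prod.mk.injEq,
      Nat.cast_inj, and_true, true_and]
    · rcases lt_trichotomy i i' with h1 | h1 | h1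
      · exact absurd (stair_snd_convex hu hw (b := (i' : ℤ) + -1) (by omega) (by omega)) hw'
      · exact h1
      · exact absurd (stair_snd_convex hw hu (b := (i : ℤ) + -1) (by omega) (by omega)) hu'
    · rcases lt_trichotomy j j' with h1 | h1 | h1
      · exact absurd (stair_fst_convex hu hw (b := (j : ℤ) + 1) (by omega) (by omega)) hu'
      · exact h1
      · exact absurd (stair_fst_convex hw hu (b := (j' : ℤ) + 1) (by omega) (by omega)) hw'
    · rcases lt_trichotomy i i' with h1 | h1 | h1
      · exact absurd (stair_snd_convex hu hw (b := (i : ℤ) + 1) (by omega) (by omega)) hu'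
      · exact h1
      · exact absurd (stair_snd_convex hw hu (b := (i' : ℤ) + 1) (by omega) (by omega)) hw'
    · rcases lt_trichotomy j j' with h1 | h1 | h1
      · exact absurd (stair_fst_convex hu hw (b := (j' : ℤ) + -1) (by omega) (by omega)) hw'
      · exact h1
      · exact absurd (stair_fst_convex hw hu (b := (j : ℤ) + -1) (by omega) (by omega)) hu'

/-- The vertices `0` and `(m, n)`. -/
abbrev corners (m n : ℕ) : Set (ℤ × ℤ) := {((0 : ℤ), (0 : ℤ)), ((m : ℤ), (n : ℤ))}

lemma exists_split_of_mem {m n L : ℕ} {γ : Set (Sym2 (ℤ × ℤ))}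
    (h : γ ∈ contoursAround (corners m n) L) :
    ∃ l r τ, Split (interior γ) m n l r τ ∧ period (interior γ) ((l, 0), 3) = L := by
  obtain ⟨hγ, hsub, hcard⟩ := h
  have hV := isRegion_interior hγ
  obtain ⟨l, r, τ, hs⟩ := exists_split hV (hsub (Or.inl rfl)) (hsub (Or.inr rfl))
  refine ⟨l, r, τ, hs, ?_⟩
  rw [← ncard_edgeBoundary hV hs.valid, edgeBoundary_interior hγ, hcard]

namespace Split

variable {V : Set (ℤ × ℤ)} {m n : ℕ} {l r : ℤ} {τ : ℕ}

lemma le_period (h : Split V m n l r τ) :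
    (minLen m n : ℤ) - 2 * l + 2 * (r - m) ≤ period V ((l, 0), 3) := by
  have h1 := h.le_count
  have h2 := length_eq_count (word V l)
  rw [length_word] at h2
  unfold minLen
  push_cast
  omega

end Split

/-- Convexity bounds the length from above and the count of necessary steps from below. The
arguments are exchanged because `stair` is reflected in the diagonal. -/
lemma Admissible.mem_minContours {m n : ℕ} {p : List (Fin 4) × List (Fin 4)}
    (h : Admissible m n p) : edgeBoundary (stair m n p) ∈ minContours n m := by
  have hi := interior_edgeBoundary h.isRegion
  refine ⟨isContour_edgeBoundary h.isRegion, ?_, ?_⟩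
  · rw [hi]
    rintro v (rfl | rfl)
    · exact h.zero_mem
    · exact h.top_mem
  · refine le_antisymm ((ncard_edgeBoundary_stair_le m n p).trans (by unfold minLen; omega)) ?_
    obtain ⟨l, r, τ, hs⟩ := exists_split h.isRegion h.zero_mem h.top_mem
    rw [ncard_edgeBoundary h.isRegion hs.valid]
    have h1 := hs.le_period
    have h2 := hs.fst.hl
    have h3 := hs.fst.hr
    omega

/-! ### Counting words -/

/-- The words of length `L`. -/
def words : ℕ → Finset (List (Fin 4))
  | 0 => {[]}
  | L + 1 => Finset.image₂ List.cons Finset.univ (words L)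

lemma mem_words {L : ℕ} {W : List (Fin 4)} : W ∈ words L ↔ W.length = L := by
  induction L generalizing W with
  | zero => simp [words, List.length_eq_zero_iff]
  | succ L ih =>
    rw [words, Finset.mem_image₂]
    constructor
    · rintro ⟨k, -, W', hW', rfl⟩
      simp [ih.1 hW']
    · intro h
      cases W with
      | nil => simp at h
      | cons k W => exact ⟨k, Finset.mem_univ _, W, ih.2 (by simpa using h), rfl⟩

lemma card_words_le (L : ℕ) : (words L).card ≤ 4 ^ L := by
  induction L with
  | zero => simp [words]
  | succ L ih =>
    rw [words]
    refine (Finset.card_image₂_le _ _ _).trans ?_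
    rw [pow_succ, mul_comm]
    simpa using ih

open Classical in
/-- The number of words of length `L` that contain a given subword. -/
lemma card_superwords_le (L : ℕ) (w : List (Fin 4)) :
    ((words L).filter fun W => w.Sublist W).card ≤ L.choose w.length * 4 ^ (L - w.length) := by
  induction L generalizing w with
  | zero =>
    cases w with
    | nil => simp [words]
    | cons a w => simp [words]
  | succ L ih =>
    cases w with
    | nil => simpa using card_words_le (L + 1)
    | cons a w =>
      -- Either the first letter is used as `a`, or it is one of four free letters followed by a
      -- word that still contains `a :: w`; the two cases are the two terms of Pascal's rule.
      have hsub : ((words (L + 1)).filter fun W => (a :: w).Sublist W) ⊆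
          ((words L).filter fun W => w.Sublist W).image (List.cons a) ∪
          Finset.image₂ List.cons Finset.univ ((words L).filter fun W => (a :: w).Sublist W) := by
        intro W hW
        rw [Finset.mem_filter, words, Finset.mem_image₂] at hW
        obtain ⟨⟨k, -, W', hW', rfl⟩, hs⟩ := hW
        rw [Finset.mem_union]
        cases hs with
        | cons _ hs =>
          right
          exact Finset.mem_image₂.2 ⟨k, Finset.mem_univ _, W', Finset.mem_filter.2 ⟨hW', hs⟩, rfl⟩
        | cons_cons _ hs =>
          left
          exact Finset.mem_image.2 ⟨W', Finset.mem_filter.2 ⟨hW', hs⟩, rfl⟩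
      refine (Finset.card_le_card hsub).trans ((Finset.card_union_le _ _).trans ?_)
      have h1 := (Finset.card_image_le (f := List.cons a)).trans (ih w)
      have h2 := (Finset.card_image₂_le List.cons (Finset.univ : Finset (Fin 4))
        ((words L).filter fun W => (a :: w).Sublist W)).trans
          (Nat.mul_le_mul_left _ (ih (a :: w)))
      refine (Nat.add_le_add h1 h2).trans ?_
      simp only [Finset.card_univ, Fintype.card_fin, List.length_cons]
      rw [Nat.add_sub_add_right, Nat.choose_succ_succ, add_mul]
      refine Nat.add_le_add_left ?_ _
      rcases Nat.lt_or_ge L (w.length + 1) with h | h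
      · simp [Nat.choose_eq_zero_of_lt h]
      · rw [show L - w.length = L - (w.length + 1) + 1 by omega, pow_succ]
        exact le_of_eq (by ring)

/-- Consecutive headings are never opposite. -/
abbrev NoReversal (W : List (Fin 4)) : Prop := List.IsChain (fun a b => b ≠ a + 2) W

lemma card_noReversal_le (L : ℕ) (a : Fin 4) :
    ((words L).filter fun W => NoReversal (a :: W)).card ≤ 3 ^ L := by
  induction L generalizing a with
  | zero => simp [words, Finset.filter_singleton]
  | succ L ih =>
    have hsub : ((words (L + 1)).filter fun W => NoReversal (a :: W)) ⊆
        (Finset.univ.erase (a + 2)).biUnion fun k =>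
          ((words L).filter fun W => NoReversal (k :: W)).image (List.cons k) := by
      intro W hW
      rw [Finset.mem_filter, words, Finset.mem_image₂] at hW
      obtain ⟨⟨k, -, W', hW', rfl⟩, hs⟩ := hW
      rw [NoReversal, List.isChain_cons_cons] at hs
      rw [Finset.mem_biUnion]
      exact ⟨k, by simpa using hs.1, Finset.mem_image.2 ⟨W', Finset.mem_filter.2 ⟨hW', hs.2⟩, rfl⟩⟩
    refine (Finset.card_le_card hsub).trans ((Finset.card_biUnion_le_card_mul _ _ (3 ^ L) ?_).trans ?_)
    · intro k _
      exact Finset.card_image_le.trans (ih k)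
    · rw [Finset.card_erase_of_mem (Finset.mem_univ _), pow_succ, mul_comm]
      simp

lemma noReversal_headings {s : ℕ → State} {T : ℕ}
    (hs : ∀ t, t + 1 < T → (s (t + 1)).2 ≠ (s t).2 + 2) : NoReversal (headings s T) := by
  unfold NoReversal headings
  rw [List.isChain_iff_getElem]
  intro i hi
  simp at hi ⊢
  exact hs i hi

lemma Split.noReversal_word (V : Set (ℤ × ℤ)) (l : ℤ) : NoReversal (3 :: Split.word V l) := by
  have : 3 :: Split.word V l = headings (trace V ((l, 0), 3)) (period V ((l, 0), 3) + 1) := by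
    unfold Split.word headings
    rw [List.range_succ_eq_map, List.map_cons, List.map_map, trace_zero]
    congr 1
    refine List.map_congr_left fun t _ => ?_
    simp only [Function.comp]
    congr 2; omega
  rw [this]
  refine noReversal_headings fun t _ => ?_
  rw [trace_succ]
  exact next_heading _ _

/-- A region is determined by the starting point and the word of its boundary cycle. -/
lemma edgeBoundary_subset_of_word_eq {V V' : Set (ℤ × ℤ)} {l : ℤ} (hV : IsRegion V)
    (hv : State.Valid V ((l, 0), 3)) (hv' : State.Valid V' ((l, 0), 3))
    (h : Split.word V l = Split.word V' l) : edgeBoundary V ⊆ edgeBoundary V' := by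
  have hL : period V ((l, 0), 3) = period V' ((l, 0), 3) := by
    rw [← Split.length_word, ← Split.length_word, h]
  set L := period V ((l, 0), 3) with hLdef
  have hhead : ∀ t < L, (trace V ((l, 0), 3) (1 + t)).2 = (trace V' ((l, 0), 3) (1 + t)).2 := by
    intro t ht
    have := congrArg (fun w : List (Fin 4) => w[t]?) h
    simpa [Split.word, headings, ← hLdef, ← hL, ht] using this
  have htail : ∀ t ≤ L, (trace V ((l, 0), 3) (1 + t)).tail = (trace V' ((l, 0), 3) (1 + t)).tail := by
    intro t ht
    induction t with
    | zero =>
      rw [add_zero]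
      change (trace V _ (0 + 1)).tail = (trace V' _ (0 + 1)).tail
      rw [trace_tail, trace_tail, trace_zero, trace_zero]
    | succ t ih =>
      rw [← add_assoc, trace_tail, trace_tail, ih (by omega), hhead t (by omega)]
  have hpos := period_pos hV.finite hv
  rw [edgeBoundary_eq_image hV hv]
  rintro _ ⟨t, ht, rfl⟩
  obtain ⟨t', ht', heq⟩ : ∃ t' < L, trace V ((l, 0), 3) t = trace V ((l, 0), 3) (1 + t') := by
    have ht : t < L := ht
    rcases Nat.eq_zero_or_pos t with rfl | hpt
    · refine ⟨L - 1, by omega, ?_⟩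
      rw [show 1 + (L - 1) = L by omega, trace_period, trace_zero]
    · exact ⟨t - 1, by omega, by congr 1; omega⟩
  simp only
  rw [heq]
  have h2 := hhead t' ht'
  have h1 := htail t' ht'.le
  have : trace V ((l, 0), 3) (1 + t') = trace V' ((l, 0), 3) (1 + t') := by
    refine Prod.ext ?_ h2
    unfold State.tail at h1
    rw [h2] at h1
    exact add_right_cancel h1
  rw [this]
  exact (trace_valid hv' _).edge_mem

/-! ### Counting contours -/

/-- Contours of given length are determined by a bounded offset and their word. -/
lemma exists_contour_code (m n d : ℕ) :
    ∃ f : Set (Sym2 (ℤ × ℤ)) → ℕ × List (Fin 4),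
      Set.InjOn f (contoursAround (corners m n) (minLen m n + d)) ∧
      ∀ γ ∈ contoursAround (corners m n) (minLen m n + d),
        (f γ).1 < d / 2 + 1 ∧ (f γ).2.length = minLen m n + d ∧ NoReversal (3 :: (f γ).2) ∧
        ∃ p, Admissible m n p ∧ (pairWord p).Sublist (f γ).2 := by
  have hex : ∀ γ ∈ contoursAround (corners m n) (minLen m n + d), ∃ l : ℤ, ∃ r τ,
      Split (interior γ) m n l r τ ∧ period (interior γ) ((l, 0), 3) = minLen m n + d :=
    fun γ hγ => exists_split_of_mem hγ
  choose! l r τ hs hp using hex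
  -- As `l ≤ 0`, `toNat` loses nothing. Each unit of `-l` costs two extra edges, which bounds the
  -- offset by `d / 2`.
  refine ⟨fun γ => ((- l γ).toNat, Split.word (interior γ) (l γ)), ?_, ?_⟩
  · intro γ hγ γ' hγ' h
    rw [Prod.mk.injEq] at h
    obtain ⟨h1, h2⟩ := h
    have e1 := (hs γ hγ).fst.hl
    have e2 := (hs γ' hγ').fst.hl
    have hl : l γ' = l γ := by omega
    rw [hl] at h2
    have hv := (hs γ hγ).valid
    have hv' := (hs γ' hγ').valid
    rw [hl] at hv'
    rw [← edgeBoundary_interior hγ.1, ← edgeBoundary_interior hγ'.1]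
    exact Set.Subset.antisymm
      (edgeBoundary_subset_of_word_eq (isRegion_interior hγ.1) hv hv' h2)
      (edgeBoundary_subset_of_word_eq (isRegion_interior hγ'.1) hv' hv h2.symm)
  · intro γ hγ
    have h1 := (hs γ hγ).le_period
    rw [hp γ hγ] at h1
    have h2 := (hs γ hγ).fst.hr
    refine ⟨?_, ?_, Split.noReversal_word _ _, ?_⟩
    · simp only
      push_cast at h1
      omega
    · simp only [Split.length_word, hp γ hγ]
    · exact exists_admissible (isRegion_interior hγ.1) (hγ.2.1 (Or.inl rfl))
        (hγ.2.1 (Or.inr rfl)) (hs γ hγ)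

lemma contoursAround_finite (m n d : ℕ) :
    (contoursAround (corners m n) (minLen m n + d)).Finite := by
  obtain ⟨f, hf, hf'⟩ := exists_contour_code m n d
  refine Set.Finite.of_finite_image (Set.Finite.subset
    (Finset.finite_toSet (Finset.range (d / 2 + 1) ×ˢ words (minLen m n + d))) ?_) hf
  rintro _ ⟨γ, hγ, rfl⟩
  obtain ⟨h1, h2, -⟩ := hf' γ hγ
  simp only [Finset.coe_product, Set.mem_prod, Finset.mem_coe, Finset.mem_range, mem_words]
  exact ⟨h1, h2⟩

theorem minContours_finite (m n : ℕ) : (minContours m n).Finite := contoursAround_finite m n 0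

/-- The gain from excluding reversals pays for the choice of the starting point; `4 ≤ N` enters
through 2 · 3^4 ≤ 4^4. -/
lemma pow_bound (d N : ℕ) (hN : 4 ≤ N) : (d / 2 + 1) * 3 ^ (N + d) ≤ 4 ^ (N + d) := by
  have h1 : (d + 2) * 3 ^ d ≤ 4 * 4 ^ d := by
    induction d with
    | zero => norm_num
    | succ d ih =>
      rcases Nat.eq_zero_or_pos d with rfl | hd
      · norm_num
      · calc (d + 1 + 2) * 3 ^ (d + 1) = ((d + 1 + 2) * 3) * 3 ^ d := by ring
          _ ≤ ((d + 2) * 4) * 3 ^ d := Nat.mul_le_mul_right _ (by omega)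
          _ = 4 * ((d + 2) * 3 ^ d) := by ring
          _ ≤ 4 * (4 * 4 ^ d) := Nat.mul_le_mul_left _ ih
          _ = 4 * 4 ^ (d + 1) := by ring
  have h2 : 2 * 3 ^ N ≤ 4 ^ N := by
    obtain ⟨k, rfl⟩ := Nat.exists_eq_add_of_le hN
    have : 3 ^ k ≤ 4 ^ k := Nat.pow_le_pow_left (by norm_num) k
    rw [pow_add, pow_add]
    norm_num
    omega
  have h3 : 2 * (d / 2 + 1) ≤ d + 2 := by omega
  have h4 : 4 * ((d / 2 + 1) * 3 ^ (N + d)) ≤ 4 * 4 ^ (N + d) := by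
    calc 4 * ((d / 2 + 1) * 3 ^ (N + d)) = (2 * (d / 2 + 1)) * 3 ^ d * (2 * 3 ^ N) := by
          rw [pow_add]; ring
      _ ≤ (d + 2) * 3 ^ d * 4 ^ N := by gcongr
      _ ≤ 4 * 4 ^ d * 4 ^ N := by gcongr
      _ = 4 * 4 ^ (N + d) := by rw [pow_add]; ring
  omega

/-- The crude bound on the number of contours. -/
theorem ncard_contoursAround_le_pow (m n d : ℕ) :
    (contoursAround (corners m n) (minLen m n + d)).ncard ≤ 4 ^ (minLen m n + d) := by
  obtain ⟨f, hf, hf'⟩ := exists_contour_code m n d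
  have h1 : (contoursAround (corners m n) (minLen m n + d)).ncard ≤
      (Finset.range (d / 2 + 1) ×ˢ
        ((words (minLen m n + d)).filter fun W => NoReversal (3 :: W))).card := by
    rw [← Set.ncard_coe_finset]
    refine Set.ncard_le_ncard_of_injOn f (fun γ hγ => ?_) hf (Finset.finite_toSet _)
    obtain ⟨h1, h2, h3, -⟩ := hf' γ hγ
    simp only [Finset.coe_product, Set.mem_prod, Finset.mem_coe, Finset.mem_range,
      Finset.mem_filter, mem_words]
    exact ⟨h1, h2, h3⟩
  refine h1.trans ?_
  rw [Finset.card_product, Finset.card_range]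
  exact (Nat.mul_le_mul_left _ (card_noReversal_le _ _)).trans
    (pow_bound _ _ (by unfold minLen; omega))

lemma admissible_finite_ncard_le (m n : ℕ) :
    {p | Admissible m n p}.Finite ∧ {p | Admissible m n p}.ncard ≤ beta n m := by
  have hmaps : ∀ p ∈ {p | Admissible m n p}, edgeBoundary (stair m n p) ∈ minContours n m :=
    fun p hp => Admissible.mem_minContours hp
  have hinj : Set.InjOn (fun p => edgeBoundary (stair m n p)) {p | Admissible m n p} := by
    intro p hp p' hp' h
    refine Admissible.injective hp hp' ?_
    rw [← interior_edgeBoundary (Admissible.isRegion hp),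
      ← interior_edgeBoundary (Admissible.isRegion hp')]
    exact congrArg interior h
  exact ⟨Set.Finite.of_injOn hmaps hinj (minContours_finite n m),
    Set.ncard_le_ncard_of_injOn _ hmaps hinj (minContours_finite n m)⟩

lemma length_pairWord {m n : ℕ} {p : List (Fin 4) × List (Fin 4)} (h : Admissible m n p) :
    (pairWord p).length = minLen m n := by
  have hlen : ∀ w : List (Fin 4), IsStairWord (m + 1) (n + 1) w → w.length = m + 1 + (n + 1) := by
    intro w hw
    rw [Split.length_eq_count, hw.1, hw.2.1, List.count_eq_zero_of_not_mem (a := (2 : Fin 4)),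
      List.count_eq_zero_of_not_mem (a := (3 : Fin 4))]
    · rfl
    · intro h; simpa using hw.2.2 _ h
    · intro h; simpa using hw.2.2 _ h
  unfold pairWord minLen
  rw [List.length_append, List.length_map, hlen _ h.fst, hlen _ h.snd]
  ring

/-- Factor by factor, `N + d - i ≤ 2 * (N - i)` for `i < d`. -/
lemma choose_add_le {N d : ℕ} (h : 2 * d ≤ N) : (N + d).choose d ≤ 2 ^ d * N.choose d := by
  have key : ∀ i ≤ d, (N + d).descFactorial i ≤ 2 ^ i * N.descFactorial i := by
    intro i hi
    induction i with
    | zero => simp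
    | succ i ih =>
      rw [Nat.descFactorial_succ, Nat.descFactorial_succ]
      calc (N + d - i) * (N + d).descFactorial i
          ≤ (2 * (N - i)) * (2 ^ i * N.descFactorial i) := Nat.mul_le_mul (by omega) (ih (by omega))
        _ = 2 ^ (i + 1) * ((N - i) * N.descFactorial i) := by ring
  have := key d le_rfl
  rw [Nat.descFactorial_eq_factorial_mul_choose, Nat.descFactorial_eq_factorial_mul_choose] at this
  refine le_of_mul_le_mul_left ?_ d.factorial_pos
  linarith

/-- Origin of the constant 12: a factor 2 per extra edge from the binomial coefficient and 4 from
the inserted letter, with 3/2 absorbing the choice of the starting point. -/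
lemma half_mul_pow_le (d : ℕ) : (d / 2 + 1) * 8 ^ d ≤ 12 ^ d := by
  have h1 : (d + 2) * 2 ^ d ≤ 2 * 3 ^ d := by
    induction d with
    | zero => norm_num
    | succ d ih =>
      calc (d + 1 + 2) * 2 ^ (d + 1) = ((d + 1 + 2) * 2) * 2 ^ d := by ring
        _ ≤ ((d + 2) * 3) * 2 ^ d := Nat.mul_le_mul_right _ (by omega)
        _ = 3 * ((d + 2) * 2 ^ d) := by ring
        _ ≤ 3 * (2 * 3 ^ d) := Nat.mul_le_mul_left _ ih
        _ = 2 * 3 ^ (d + 1) := by ring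
  have h2 : 2 * ((d / 2 + 1) * 2 ^ d) ≤ 2 * 3 ^ d := by
    calc 2 * ((d / 2 + 1) * 2 ^ d) = (2 * (d / 2 + 1)) * 2 ^ d := by ring
      _ ≤ (d + 2) * 2 ^ d := Nat.mul_le_mul_right _ (by omega)
      _ ≤ _ := h1
  calc (d / 2 + 1) * 8 ^ d = ((d / 2 + 1) * 2 ^ d) * 4 ^ d := by
        rw [mul_assoc, ← mul_pow]; norm_num
    _ ≤ 3 ^ d * 4 ^ d := Nat.mul_le_mul_right _ (by omega)
    _ = 12 ^ d := by rw [← mul_pow]; norm_num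

/-- The bound on the number of contours in terms of the number of minimal contours. -/
theorem ncard_contoursAround_le_beta {m n d : ℕ} (hd : 2 * d ≤ minLen m n) :
    (contoursAround (corners m n) (minLen m n + d)).ncard ≤
      beta n m * ((minLen m n).choose d * 12 ^ d) := by
  classical
  obtain ⟨f, hf, hf'⟩ := exists_contour_code m n d
  obtain ⟨hfin, hcard⟩ := admissible_finite_ncard_le m n
  set N := minLen m n
  set S : Finset (List (Fin 4)) := hfin.toFinset.biUnion fun p =>
    (words (N + d)).filter fun W => (pairWord p).Sublist W with hS
  have h1 : (contoursAround (corners m n) (N + d)).ncard ≤ (Finset.range (d / 2 + 1) ×ˢ S).card := by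
    rw [← Set.ncard_coe_finset]
    refine Set.ncard_le_ncard_of_injOn f (fun γ hγ => ?_) hf (Finset.finite_toSet _)
    obtain ⟨h1, h2, -, p, hp, h3⟩ := hf' γ hγ
    simp only [Finset.coe_product, Set.mem_prod, Finset.mem_coe, Finset.mem_range, hS,
      Finset.mem_biUnion, Finset.mem_filter, mem_words, Set.Finite.mem_toFinset]
    exact ⟨h1, p, hp, h2, h3⟩
  have h2 : S.card ≤ beta n m * (2 ^ d * N.choose d * 4 ^ d) := by
    refine (Finset.card_biUnion_le_card_mul _ _ (2 ^ d * N.choose d * 4 ^ d) ?_).trans ?_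
    · intro p hp
      have hp : Admissible m n p := by simpa using hp
      refine (card_superwords_le _ _).trans ?_
      rw [length_pairWord hp, Nat.add_sub_cancel_left, Nat.choose_symm_add]
      exact Nat.mul_le_mul_right _ (choose_add_le hd)
    · refine Nat.mul_le_mul_right _ ?_
      rwa [← Set.ncard_eq_toFinset_card _ hfin]
  refine h1.trans ?_
  rw [Finset.card_product, Finset.card_range]
  calc (d / 2 + 1) * S.card ≤ (d / 2 + 1) * (beta n m * (2 ^ d * N.choose d * 4 ^ d)) :=
        Nat.mul_le_mul_left _ h2
    _ = beta n m * N.choose d * ((d / 2 + 1) * 8 ^ d) := by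
        rw [show (8 : ℕ) = 2 * 4 from rfl, mul_pow]; ring
    _ ≤ beta n m * N.choose d * 12 ^ d := Nat.mul_le_mul_left _ (half_mul_pow_le d)
    _ = _ := by ring

/-! ### Horizontal and vertical edges of a contour -/

lemma State.isHorizontal_edge_iff (s : State) : IsHorizontal s.edge ↔ s.2 = 1 ∨ s.2 = 3 := by
  obtain ⟨⟨a, b⟩, k⟩ := s
  unfold IsHorizontal State.edge
  simp only [Sym2.mem_iff, forall_eq_or_imp, forall_eq]
  fin_cases k <;> simp [State.out]

lemma count_headings (s : ℕ → State) (T : ℕ) (k : Fin 4) :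
    (headings s T).count k = ((Finset.range T).filter fun t => (s t).2 = k).card := by
  induction T with
  | zero => simp [headings]
  | succ T ih =>
    rw [headings_succ, List.count_append, ih, Finset.range_add_one, Finset.filter_insert]
    split_ifs with h
    · rw [Finset.card_insert_of_notMem (by simp), h]
      simp
    · rw [List.count_singleton, if_neg (by simpa using h), add_zero]

lemma trace_one_add {V : Set (ℤ × ℤ)} {s₀ : State} (hV : V.Finite) (h₀ : s₀.Valid V) :
    ∀ t < period V s₀, ∃ t' < period V s₀, trace V s₀ t = trace V s₀ (1 + t') := by
  intro t ht
  have := period_pos hV h₀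
  rcases Nat.eq_zero_or_pos t with rfl | hpt
  · refine ⟨period V s₀ - 1, by omega, ?_⟩
    rw [show 1 + (period V s₀ - 1) = period V s₀ by omega, trace_period, trace_zero]
  · exact ⟨t - 1, by omega, by congr 1; omega⟩

lemma ncard_horizontal {V : Set (ℤ × ℤ)} {l : ℤ} (hV : IsRegion V)
    (hv : State.Valid V ((l, 0), 3)) :
    (edgeBoundary V ∩ {e | IsHorizontal e}).ncard =
      (Split.word V l).count 1 + (Split.word V l).count 3 := by
  classical
  set L := period V ((l, 0), 3) with hL
  set s : ℕ → State := fun t => trace V ((l, 0), 3) (1 + t) with hs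
  have himg : edgeBoundary V ∩ {e | IsHorizontal e} = (fun t => (s t).edge) ''
      (((Finset.range L).filter fun t => (s t).2 = 1 ∨ (s t).2 = 3 : Finset ℕ) : Set ℕ) := by
    ext e
    constructor
    · rintro ⟨he, hh⟩
      rw [edgeBoundary_eq_image hV hv] at he
      obtain ⟨t, ht, rfl⟩ := he
      obtain ⟨t', ht', heq⟩ := trace_one_add hV.finite hv t ht
      refine ⟨t', ?_, by simp only [hs, heq]⟩
      have := (State.isHorizontal_edge_iff _).1 hh
      rw [heq] at this
      simp only [Finset.coe_filter, Finset.mem_range]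
      exact ⟨ht', this⟩
    · rintro ⟨t, ht, rfl⟩
      simp only [Finset.coe_filter, Finset.mem_range] at ht
      exact ⟨(trace_valid hv _).edge_mem, (State.isHorizontal_edge_iff _).2 ht.2⟩
  have hinj : Set.InjOn (fun t => (s t).edge)
      (((Finset.range L).filter fun t => (s t).2 = 1 ∨ (s t).2 = 3 : Finset ℕ) : Set ℕ) := by
    intro t ht t' ht' heq
    simp only [Finset.coe_filter, Finset.mem_range] at ht ht'
    have h1 := edge_injOn V (trace_valid hv _) (trace_valid hv _) heq
    rw [← trace_mod V _ (1 + t), ← trace_mod V _ (1 + t')] at h1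
    have hpos := period_pos hV.finite hv
    have h2 := trace_injOn (Nat.mod_lt _ hpos) (Nat.mod_lt _ hpos) h1
    have h3 : t ≡ t' [MOD L] := Nat.ModEq.add_left_cancel' 1 h2
    exact h3.eq_of_lt_of_lt ht.1 ht'.1
  rw [himg, Set.InjOn.ncard_image hinj, Set.ncard_coe_finset, Finset.filter_or,
    Finset.card_union_of_disjoint]
  · unfold Split.word
    rw [count_headings, count_headings]
  · rw [Finset.disjoint_filter]
    intro t _ h1 h2
    rw [h1] at h2
    exact absurd h2 (by decide)

/-! ### Probabilities of cylinder events -/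

open Classical in
/-- The probability that an edge is open. -/
noncomputable def openProb (ph pv : unitInterval) (e : lattice.edgeSet) : ℝ :=
  if IsHorizontal e.1 then ph else pv

lemma edgeLaw_real_true (ph pv : unitInterval) (e : lattice.edgeSet) :
    (edgeLaw ph pv e).real {true} = openProb ph pv e := by
  classical
  unfold edgeLaw openProb
  rw [bernoulliMeasure_real_apply _ (MeasurableSet.singleton _)]
  split_ifs <;> simp_all

lemma edgeLaw_real_false (ph pv : unitInterval) (e : lattice.edgeSet) :
    (edgeLaw ph pv e).real {false} = 1 - openProb ph pv e := by
  classical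
  unfold edgeLaw openProb
  rw [bernoulliMeasure_real_apply _ (MeasurableSet.singleton _)]
  split_ifs <;> simp_all

/-- The event that the edges of `C` are closed and those of `O` are open. -/
def cyl (C O : Set (Sym2 (ℤ × ℤ))) : Set Config :=
  {ω | (∀ e : lattice.edgeSet, e.1 ∈ C → ω e = false) ∧ ∀ e : lattice.edgeSet, e.1 ∈ O → ω e = true}

open Classical in
lemma cyl_eq_pi {C O : Finset lattice.edgeSet} (h : Disjoint C O) :
    cyl (Subtype.val '' (C : Set lattice.edgeSet)) (Subtype.val '' (O : Set lattice.edgeSet)) =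
      Set.pi ((C ∪ O : Finset lattice.edgeSet) : Set lattice.edgeSet)
        (fun e => if e ∈ C then {false} else {true}) := by
  ext ω
  unfold cyl
  constructor
  · rintro ⟨h1, h2⟩ e he
    rw [Finset.mem_coe, Finset.mem_union] at he
    by_cases hC : e ∈ C
    · simp only [if_pos hC]
      exact h1 e ⟨e, hC, rfl⟩
    · simp only [if_neg hC]
      exact h2 e ⟨e, he.resolve_left hC, rfl⟩
  · intro h'
    constructor
    · rintro e ⟨e', he', hee⟩
      obtain rfl : e' = e := Subtype.ext hee
      have he' : e' ∈ C := he'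
      have := h' e' (by simp [he'])
      simp only [if_pos he'] at this
      exact this
    · rintro e ⟨e', he', hee⟩
      obtain rfl : e' = e := Subtype.ext hee
      have he' : e' ∈ O := he'
      have := h' e' (by simp [he'])
      simp only [if_neg (fun hC => Finset.disjoint_left.1 h hC he')] at this
      exact this

lemma measure_cyl_finset (ph pv : unitInterval) {C O : Finset lattice.edgeSet} (h : Disjoint C O) :
    (percMeasure ph pv).real
      (cyl (Subtype.val '' (C : Set lattice.edgeSet)) (Subtype.val '' (O : Set lattice.edgeSet))) =
    (∏ e ∈ C, (1 - openProb ph pv e)) * ∏ e ∈ O, openProb ph pv e := by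
  classical
  rw [cyl_eq_pi h]
  unfold percMeasure
  rw [measureReal_def, Measure.infinitePi_pi, ENNReal.toReal_prod, Finset.prod_union h]
  · congr 1
    · refine Finset.prod_congr rfl fun e he => ?_
      rw [if_pos he]
      exact edgeLaw_real_false ph pv e
    · refine Finset.prod_congr rfl fun e he => ?_
      rw [if_neg (fun hC => Finset.disjoint_left.1 h hC he)]
      exact edgeLaw_real_true ph pv e
  · intro e _
    split_ifs <;> exact MeasurableSet.singleton _

lemma measurableSet_cyl (C O : Set (Sym2 (ℤ × ℤ))) : MeasurableSet (cyl C O) := by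
  have : cyl C O = (⋂ e : lattice.edgeSet, ⋂ _ : e.1 ∈ C, (fun ω : Config => ω e) ⁻¹' {false}) ∩
      ⋂ e : lattice.edgeSet, ⋂ _ : e.1 ∈ O, (fun ω : Config => ω e) ⁻¹' {true} := by
    ext ω
    simp only [Set.mem_inter_iff, Set.mem_iInter, Set.mem_preimage, Set.mem_singleton_iff]
    rfl
  rw [this]
  have hm : ∀ (e : lattice.edgeSet) (b : Bool), MeasurableSet ((fun ω : Config => ω e) ⁻¹' {b}) :=
    fun e b => measurable_pi_apply e (MeasurableSet.singleton b)
  have : Countable lattice.edgeSet := inferInstance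
  exact (MeasurableSet.iInter fun e => MeasurableSet.iInter fun _ => hm e false).inter
    (MeasurableSet.iInter fun e => MeasurableSet.iInter fun _ => hm e true)

lemma exists_finset_edges {γ : Set (Sym2 (ℤ × ℤ))} (hsub : γ ⊆ lattice.edgeSet) (hfin : γ.Finite) :
    ∃ C : Finset lattice.edgeSet, γ = Subtype.val '' (C : Set lattice.edgeSet) := by
  refine ⟨(hfin.preimage Subtype.val_injective.injOn).toFinset, ?_⟩
  ext e
  simp only [Set.Finite.coe_toFinset, Set.mem_image, Set.mem_preimage, Subtype.exists,
    exists_and_left, exists_prop, exists_eq_right_right]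
  exact ⟨fun h => ⟨h, hsub h⟩, fun h => h.1⟩

open Classical in
lemma prod_one_sub_openProb (ph pv : unitInterval) (C : Finset lattice.edgeSet) {a b : ℕ}
    (ha : ((Subtype.val '' (C : Set lattice.edgeSet)) ∩ {e | IsHorizontal e}).ncard = a)
    (hab : (Subtype.val '' (C : Set lattice.edgeSet)).ncard = a + b) :
    ∏ e ∈ C, (1 - openProb ph pv e) = (1 - (ph : ℝ)) ^ a * (1 - (pv : ℝ)) ^ b := by
  have h1 : (C.filter fun e => IsHorizontal e.1).card = a := by
    rw [← ha, ← Set.ncard_coe_finset, ← Set.InjOn.ncard_image Subtype.val_injective.injOn]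
    congr 1
    ext e
    simp only [Finset.coe_filter, Set.mem_image, Set.mem_inter_iff, Finset.mem_coe]
    constructor
    · rintro ⟨e, ⟨h1, h2⟩, rfl⟩
      exact ⟨⟨e, h1, rfl⟩, h2⟩
    · rintro ⟨⟨e, h1, rfl⟩, h2⟩
      exact ⟨e, ⟨h1, h2⟩, rfl⟩
  have h2 : C.card = a + b := by
    rw [← hab, Set.InjOn.ncard_image Subtype.val_injective.injOn, Set.ncard_coe_finset]
  have h3 : (C.filter fun e => ¬ IsHorizontal e.1).card = b := by
    have := Finset.card_filter_add_card_filter_not (s := C) (fun e => IsHorizontal e.1)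
    omega
  rw [← Finset.prod_filter_mul_prod_filter_not C fun e => IsHorizontal e.1]
  congr 1
  · rw [← h1, ← Finset.prod_const]
    refine Finset.prod_congr rfl fun e he => ?_
    rw [openProb, if_pos (Finset.mem_filter.1 he).2]
  · rw [← h3, ← Finset.prod_const]
    refine Finset.prod_congr rfl fun e he => ?_
    rw [openProb, if_neg (Finset.mem_filter.1 he).2]

/-! ### Inner boundary of a minimal contour -/

/-- A finite set of lattice edges with both endpoints in `V`. -/
def IsInner (V : Set (ℤ × ℤ)) (E : Finset (Sym2 (ℤ × ℤ))) : Prop :=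
  ∀ e ∈ E, ∃ u w, e = s(u, w) ∧ lattice.Adj u w ∧ u ∈ V ∧ w ∈ V

/-- The headings `0, 1` for the sign `1` and the headings `2, 3` for the sign `-1`. -/
def SignedHeading (ε : ℤ) (k : Fin 4) : Prop := (ε = 1 ∧ (k = 0 ∨ k = 1)) ∨ (ε = -1 ∧ (k = 2 ∨ k = 3))

/-- A left turn keeps the inner vertex, a straight step needs one inner edge, and a right turn two
edges around the corner. When both headings have the same sign, every edge used advances the
coordinate sum in that direction, so the number of edges telescopes. -/
lemma exists_link {V : Set (ℤ × ℤ)} {s : State} (hs : s.1 ∈ V) {ε : ℤ} (h1 : SignedHeading ε s.2)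
    (h2 : SignedHeading ε (next V s).2) :
    ∃ E : Finset (Sym2 (ℤ × ℤ)), IsInner V E ∧
      (E.card : ℤ) ≤ ε * (((next V s).1.1 + (next V s).1.2) - (s.1.1 + s.1.2)) ∧
      ∀ G : SimpleGraph (ℤ × ℤ), (E : Set (Sym2 (ℤ × ℤ))) ⊆ G.edgeSet →
        G.Reachable s.1 (next V s).1 := by
  obtain ⟨u, k⟩ := s
  rcases next_cases V (u, k) with ⟨c1, h⟩ | ⟨c1, c2, h⟩ | ⟨c1, c2, h⟩ <;> rw [h] at h2 ⊢ <;>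
    simp only at h1 h2 hs c1
  · refine ⟨∅, by simp [IsInner], by simp, fun G _ => SimpleGraph.Reachable.refl _⟩
  · refine ⟨{s(u, u + vec k)}, ?_, ?_, fun G hG => ?_⟩
    · simp only [IsInner, Finset.mem_singleton, forall_eq]
      exact ⟨_, _, rfl, adj_add_vec _ _, hs, c1⟩
    · rcases h1 with ⟨rfl, rfl | rfl⟩ | ⟨rfl, rfl | rfl⟩ <;> simp
    · have a1 : s(u, u + vec k) ∈ G.edgeSet := hG (by simp)
      exact SimpleGraph.Adj.reachable a1
  · simp only at c2
    refine ⟨{s(u, u + vec k), s(u + vec k, u + vec k + vec (k + 3))}, ?_, ?_, fun G hG => ?_⟩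
    · simp only [IsInner, Finset.mem_insert, Finset.mem_singleton, forall_eq_or_imp, forall_eq]
      exact ⟨⟨_, _, rfl, adj_add_vec _ _, hs, c1⟩, ⟨_, _, rfl, adj_add_vec _ _, c1, c2⟩⟩
    · refine le_trans (Nat.cast_le.2 Finset.card_le_two) ?_
      rcases h1 with ⟨rfl, rfl | rfl⟩ | ⟨rfl, rfl | rfl⟩ <;> simp [SignedHeading] at h2 ⊢ <;> omega
    · have a1 : s(u, u + vec k) ∈ G.edgeSet := hG (by simp)
      have a2 : s(u + vec k, u + vec k + vec (k + 3)) ∈ G.edgeSet := hG (by simp)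
      exact (SimpleGraph.Adj.reachable a1).trans (SimpleGraph.Adj.reachable a2)

lemma exists_chain {V : Set (ℤ × ℤ)} {s₀ : State} (hv : s₀.Valid V) {ε : ℤ} (t₀ d : ℕ)
    (h : ∀ t ≤ d, SignedHeading ε (trace V s₀ (t₀ + t)).2) :
    ∃ E : Finset (Sym2 (ℤ × ℤ)), IsInner V E ∧
      (E.card : ℤ) ≤ ε * (((trace V s₀ (t₀ + d)).1.1 + (trace V s₀ (t₀ + d)).1.2) -
        ((trace V s₀ t₀).1.1 + (trace V s₀ t₀).1.2)) ∧
      ∀ G : SimpleGraph (ℤ × ℤ), (E : Set (Sym2 (ℤ × ℤ))) ⊆ G.edgeSet → ∀ t ≤ d,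
        G.Reachable (trace V s₀ t₀).1 (trace V s₀ (t₀ + t)).1 := by
  classical
  induction d with
  | zero =>
    refine ⟨∅, by simp [IsInner], by simp, fun G _ t ht => ?_⟩
    obtain rfl : t = 0 := by omega
    exact SimpleGraph.Reachable.refl _
  | succ d ih =>
    obtain ⟨E, hE1, hE2, hE3⟩ := ih fun t ht => h t (by omega)
    obtain ⟨E', hE1', hE2', hE3'⟩ := exists_link (trace_valid hv (t₀ + d)).1 (h d (by omega))
      (by rw [← trace_succ]; exact h (d + 1) le_rfl)
    rw [← trace_succ, add_assoc] at hE2'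
    refine ⟨E ∪ E', ?_, ?_, fun G hG t ht => ?_⟩
    · intro e he
      rcases Finset.mem_union.1 he with he | he
      · exact hE1 e he
      · exact hE1' e he
    · refine le_trans (Nat.cast_le.2 (Finset.card_union_le E E')) ?_
      push_cast
      refine (add_le_add hE2 hE2').trans (le_of_eq ?_)
      ring
    · rw [Finset.coe_union, Set.union_subset_iff] at hG
      rcases Nat.lt_or_ge t (d + 1) with hlt | hge
      · exact hE3 G hG.1 t (by omega)
      · obtain rfl : t = d + 1 := by omega
        have := hE3' G hG.2
        rw [← trace_succ] at this
        exact (hE3 G hG.1 d le_rfl).trans this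

/-- The data of a minimal contour: its numbers of horizontal and vertical edges, and few inner edges
that connect all vertices along it. -/
theorem exists_inner_of_mem_minContours {m n : ℕ} {γ : Set (Sym2 (ℤ × ℤ))}
    (h : γ ∈ minContours m n) :
    (γ ∩ {e | IsHorizontal e}).ncard = 2 * (n + 1) ∧
    ∃ E : Finset (Sym2 (ℤ × ℤ)), IsInner (interior γ) E ∧ E.card ≤ minLen m n ∧
      ∀ G : SimpleGraph (ℤ × ℤ), (E : Set (Sym2 (ℤ × ℤ))) ⊆ G.edgeSet →
        ∀ s : State, s.Valid (interior γ) → G.Reachable (0, 0) s.1 := by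
  classical
  obtain ⟨l, r, τ, hs, hp⟩ := exists_split_of_mem h
  have hV := isRegion_interior h.1
  have hle := hs.le_period
  have hl := hs.fst.hl
  have hr := hs.fst.hr
  have hlt := hs.lt
  rw [hp] at hle
  -- Minimal length leaves no slack, so all step counts are equalities: `l = 0`, `r = m`, and
  -- neither half contains a step against its orientation.
  obtain rfl : l = 0 := by omega
  obtain rfl : r = m := by omega
  set V := interior γ with hVdef
  have hcount := hs.le_count
  have hlen := Split.length_eq_count (Split.word V 0)
  rw [Split.length_word, hp] at hlen
  have hhor := ncard_horizontal hV hs.valid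
  rw [edgeBoundary_interior h.1] at hhor
  have hc1 := hs.fst.le_count
  have hc2 := hs.snd.le_count
  have hl1 := Split.length_eq_count (headings (fun t => trace V ((0, 0), 3) (1 + t)) τ)
  have hl2 := Split.length_eq_count (headings (fun t => (trace V ((0, 0), 3) (τ + 1 + t)).turn m n)
        (period V ((0, 0), 3) - τ))
  rw [length_headings] at hl1 hl2
  rw [hp] at hl2 hlt
  rw [hp] at hc2
  set L := minLen m n with hL
  have hLdef : L = 2 * (m + n + 2) := rfl
  refine ⟨by omega, ?_⟩
  have hzero : ∀ (s : ℕ → State) (T : ℕ), (headings s T).count 2 = 0 → (headings s T).count 3 = 0 →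
      ∀ t < T, (s t).2 = 0 ∨ (s t).2 = 1 := by
    intro s T h2 h3 t ht
    rw [List.count_eq_zero] at h2 h3
    have hmem : (s t).2 ∈ headings s T := List.mem_map.2 ⟨t, List.mem_range.2 ht, rfl⟩
    have hk2 : (s t).2 ≠ 2 := fun hk => h2 (hk ▸ hmem)
    have hk3 : (s t).2 ≠ 3 := fun hk => h3 (hk ▸ hmem)
    revert hk2 hk3
    generalize (s t).2 = k
    revert k; decide
  have hfst := hzero _ _ (by omega : (headings (fun t => trace V ((0, 0), 3) (1 + t)) τ).count 2 = 0)
    (by omega)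
  have hsnd := hzero (fun t => (trace V ((0, 0), 3) (τ + 1 + t)).turn m n) (L - τ) (by omega)
    (by omega)
  have hτ0 : 0 < τ := by omega
  -- After the southward step only a left turn produces heading `0` or `1`, so the inner vertex does
  -- not move.
  have hu1 : (trace V ((0, 0), 3) 1).1 = (0, 0) := by
    have hh := hfst 0 hτ0
    simp only [add_zero] at hh
    have htr : trace V ((0, 0), 3) 1 = next V ((0, 0), 3) := trace_succ V _ 0
    rw [htr] at hh ⊢
    rcases next_cases V ((0, 0), 3) with ⟨_, h⟩ | ⟨_, _, h⟩ | ⟨_, _, h⟩ <;> rw [h] at hh ⊢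
    · simp at hh
    · simp at hh
  have hu2 : (trace V ((0, 0), 3) (τ + 1)).1 = ((m : ℤ), (n : ℤ)) := by
    have hh := hsnd 0 (by omega)
    simp only [add_zero, State.turn] at hh
    rw [trace_succ, hs.trace_eq] at hh ⊢
    rcases next_cases V (((m : ℤ), (n : ℤ)), 1) with ⟨_, h⟩ | ⟨_, _, h⟩ | ⟨_, _, h⟩ <;>
      rw [h] at hh ⊢
    · simp at hh
    · simp at hh
  obtain ⟨E₁, hE1, hE2, hE3⟩ := exists_chain hs.valid (ε := 1) 1 (τ - 1)
    (fun t ht => Or.inl ⟨rfl, hfst t (by omega)⟩)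
  obtain ⟨E₂, hE1', hE2', hE3'⟩ := exists_chain hs.valid (ε := -1) (τ + 1) (L - τ - 1) (by
    intro t ht
    refine Or.inr ⟨rfl, ?_⟩
    have := hsnd t (by omega)
    simp only [State.turn] at this
    revert this
    generalize (trace V ((0, 0), 3) (τ + 1 + t)).2 = k
    revert k; decide)
  rw [show 1 + (τ - 1) = τ by omega, hs.trace_eq, hu1] at hE2
  have htL : trace V ((0, 0), 3) L = ((0, 0), 3) := by rw [← hp]; exact trace_period _ _
  rw [show τ + 1 + (L - τ - 1) = L by omega, htL, hu2] at hE2'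
  simp only at hE2 hE2'
  refine ⟨E₁ ∪ E₂, ?_, ?_, ?_⟩
  · intro e he
    rcases Finset.mem_union.1 he with he | he
    · exact hE1 e he
    · exact hE1' e he
  · refine (Finset.card_union_le _ _).trans ?_
    omega
  · intro G hG s hsv
    rw [Finset.coe_union, Set.union_subset_iff] at hG
    obtain ⟨t, ht, rfl⟩ := exists_trace_eq hV hs.valid hsv
    rw [hp] at ht
    have r1 := hE3 G hG.1
    have r2 := hE3' G hG.2
    rw [hu1] at r1
    rw [hu2] at r2
    rcases Nat.lt_or_ge τ t with hlt' | hge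
    · have e1 := r1 (τ - 1) le_rfl
      rw [show 1 + (τ - 1) = τ by omega, hs.trace_eq] at e1
      have e2 := r2 (t - (τ + 1)) (by omega)
      rw [show τ + 1 + (t - (τ + 1)) = t by omega] at e2
      exact e1.trans e2
    · rcases Nat.eq_zero_or_pos t with rfl | hpos
      · exact SimpleGraph.Reachable.refl _
      · have e1 := r1 (t - 1) (by omega)
        rwa [show 1 + (t - 1) = t by omega] at e1

/-! ### Open clusters -/

/-- The graph of open edges. -/
def openGraph (ω : Config) : SimpleGraph (ℤ × ℤ) where
  Adj u v := ∃ h : lattice.Adj u v, ω ⟨s(u, v), h⟩ = true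
  symm := ⟨by
    rintro u v ⟨h, hω⟩
    refine ⟨h.symm, ?_⟩
    rw [← hω]
    congr 2
    exact Sym2.eq_swap⟩
  loopless := ⟨fun u ⟨h, _⟩ => lattice.loopless.irrefl u h⟩

/-- The open cluster of a vertex. -/
def cluster (ω : Config) (x : ℤ × ℤ) : lattice.Subgraph where
  verts := {v | (openGraph ω).Reachable x v}
  Adj u v := (openGraph ω).Reachable x u ∧ (openGraph ω).Adj u v
  adj_sub := fun h => h.2.1
  edge_vert := fun h => h.1
  symm := ⟨fun _ _ h => ⟨h.1.trans h.2.reachable, h.2.symm⟩⟩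

lemma isOpenCluster_cluster (ω : Config) (x : ℤ × ℤ) : IsOpenCluster ω (cluster ω x) := by
  refine ⟨?_, ?_, ?_⟩
  · have key : ∀ v, ∀ hv : (openGraph ω).Reachable x v, (cluster ω x).coe.Reachable
        ⟨x, SimpleGraph.Reachable.refl x⟩ ⟨v, hv⟩ := by
      intro v hv
      have hv' := hv
      rw [SimpleGraph.reachable_iff_reflTransGen] at hv'
      induction hv' with
      | refl => exact SimpleGraph.Reachable.refl _
      | tail hab hbc ih =>
        rw [← SimpleGraph.reachable_iff_reflTransGen] at hab
        refine (ih hab).trans (SimpleGraph.Adj.reachable ?_)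
        exact ⟨hab, hbc⟩
    rw [SimpleGraph.Subgraph.connected_iff']
    have : Nonempty (cluster ω x).verts := ⟨⟨x, SimpleGraph.Reachable.refl x⟩⟩
    refine ⟨?_⟩
    rintro ⟨u, hu⟩ ⟨v, hv⟩
    exact (key u hu).symm.trans (key v hv)
  · rintro ⟨e, he⟩ h
    induction e using Sym2.ind with
    | _ u v => exact h.2.2
  · rintro ⟨e, he⟩ h
    obtain ⟨u, w, rfl, huw, hu, hw⟩ := exists_of_mem_edgeBoundary h
    by_contra hc
    rw [Bool.not_eq_false] at hc
    have hadj : (openGraph ω).Adj u w := ⟨huw, hc⟩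
    exact hw (SimpleGraph.Reachable.trans hu hadj.reachable)

lemma cluster_subset {ω : Config} {V : Set (ℤ × ℤ)} {x : ℤ × ℤ} (hx : x ∈ V)
    (hω : ∀ e : lattice.edgeSet, e.1 ∈ edgeBoundary V → ω e = false) {v : ℤ × ℤ}
    (hv : (openGraph ω).Reachable x v) : v ∈ V := by
  refine mem_of_reachable (S := V) ?_ hv hx
  rintro u w hu ⟨huw, ho⟩
  by_contra hw
  have := hω ⟨s(u, w), huw⟩ (mem_edgeBoundary.2 ⟨huw, fun h => hw (h.1 hu)⟩)
  rw [this] at ho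
  exact absurd ho (by decide)

lemma edgeSet_finite {A : lattice.Subgraph} (h : A.verts.Finite) : A.edgeSet.Finite := by
  refine ((h.prod h).image fun p => s(p.1, p.2)).subset fun e he => ?_
  induction e using Sym2.ind with
  | _ u v =>
    exact ⟨(u, v), ⟨A.edge_vert he, A.edge_vert (A.adj_symm he)⟩, rfl⟩

/-- If the cluster of `0` contains the inner boundary of `V'` and is contained in `V`, then
`V'` is contained in `V`. -/
lemma subset_of_inner_boundary {V V' C : Set (ℤ × ℤ)} (hV : IsRegion V) (hV' : IsRegion V')
    (hC : C ⊆ V) (hb : ∀ s : State, s.Valid V' → s.1 ∈ C) : V' ⊆ V := by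
  intro w hw
  by_contra hwV
  obtain ⟨z, hz, hz'⟩ := ((hV.compl w hwV).sdiff hV'.finite).nonempty
  refine hz' (mem_of_reachable (S := V' ∩ {v | v ∉ V}) ?_ hz ⟨hw, hwV⟩).1
  rintro u u' ⟨hu, huV⟩ hadj
  obtain ⟨h1, h2⟩ := cutGraph_adj.1 hadj
  refine ⟨?_, fun h => huV (h2.2 h)⟩
  by_contra hu'
  obtain ⟨k, rfl⟩ := exists_vec_of_adj h1
  have hk : k + 1 + 3 = k := (fin_four_add k).1
  exact huV (hC (hb (u, k + 1) ⟨hu, by simpa [State.out, hk] using hu'⟩))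

/-! ### The lower bound -/

lemma le_openProb {ph pv : unitInterval} (hpv : (ph : ℝ) ≤ pv) (e : lattice.edgeSet) :
    (ph : ℝ) ≤ openProb ph pv e := by
  unfold openProb; split_ifs
  · exact le_rfl
  · exact hpv

lemma lam_nonneg (p : unitInterval) : 0 ≤ lam p :=
  div_nonneg (sub_nonneg.2 p.2.2) p.2.1

lemma lam_mul {p : unitInterval} (hp : 0 < (p : ℝ)) : lam p * p = 1 - p := by
  unfold lam; field_simp

/-- Writing 1 - p = λ p for the closed edges gives ‖x‖ factors that are at least p_h, and the open
inner edges give at most ‖x‖ more. -/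
lemma prob_minContour_ge {ph pv : unitInterval} (hph : 0 < (ph : ℝ)) (hpv : (ph : ℝ) ≤ pv)
    {m n : ℕ} {γ : Set (Sym2 (ℤ × ℤ))} (hγ : γ ∈ minContours m n)
    (hH : (γ ∩ {e | IsHorizontal e}).ncard = 2 * (n + 1)) {E : Finset (Sym2 (ℤ × ℤ))}
    (hE : IsInner (interior γ) E) (hcard : E.card ≤ minLen m n) :
    lam ph ^ (2 * (n + 1)) * lam pv ^ (2 * (m + 1)) * (ph : ℝ) ^ (2 * minLen m n) ≤
      (percMeasure ph pv).real (cyl γ E) := by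
  obtain ⟨C, hC⟩ := exists_finset_edges hγ.1.1 hγ.1.2.1
  have hEsub : (E : Set (Sym2 (ℤ × ℤ))) ⊆ lattice.edgeSet := by
    intro e he
    obtain ⟨u, w, rfl, huw, -⟩ := hE e he
    exact huw
  obtain ⟨O, hO⟩ := exists_finset_edges hEsub E.finite_toSet
  have hdisj : Disjoint C O := by
    rw [Finset.disjoint_left]
    intro e he he'
    have h1 : e.1 ∈ γ := by rw [hC]; exact ⟨e, he, rfl⟩
    have h2 : e.1 ∈ (E : Set (Sym2 (ℤ × ℤ))) := by rw [hO]; exact ⟨e, he', rfl⟩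
    obtain ⟨u, w, h3, huw, hu, hw⟩ := hE e.1 h2
    rw [← edgeBoundary_interior hγ.1, h3, mem_edgeBoundary] at h1
    exact h1.2 (iff_of_true hu hw)
  have hOcard : O.card ≤ minLen m n := by
    have : O.card = (E : Set (Sym2 (ℤ × ℤ))).ncard := by
      rw [hO, Set.InjOn.ncard_image Subtype.val_injective.injOn, Set.ncard_coe_finset]
    rwa [this, Set.ncard_coe_finset]
  have hncard : γ.ncard = 2 * (n + 1) + 2 * (m + 1) := by
    rw [hγ.2.2]; unfold minLen; ring
  have hmeas := measure_cyl_finset ph pv hdisj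
  rw [← hC, ← hO] at hmeas
  rw [hmeas, prod_one_sub_openProb ph pv C (a := 2 * (n + 1)) (b := 2 * (m + 1))
    (by rw [← hC]; exact hH) (by rw [← hC]; exact hncard)]
  have hpv0 : 0 < (pv : ℝ) := hph.trans_le hpv
  have hprod : (ph : ℝ) ^ minLen m n ≤ ∏ e ∈ O, openProb ph pv e := by
    calc (ph : ℝ) ^ minLen m n ≤ (ph : ℝ) ^ O.card := pow_le_pow_of_le_one hph.le ph.2.2 hOcard
      _ = ∏ _e ∈ O, (ph : ℝ) := by rw [Finset.prod_const]
      _ ≤ _ := Finset.prod_le_prod (fun _ _ => hph.le) fun e _ => le_openProb hpv e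
  rw [← lam_mul hph, ← lam_mul hpv0, mul_pow, mul_pow]
  have h1 : (ph : ℝ) ^ (2 * minLen m n) = (ph : ℝ) ^ (2 * (n + 1)) * (ph : ℝ) ^ (2 * (m + 1)) *
      (ph : ℝ) ^ minLen m n := by
    rw [← pow_add, ← pow_add]; congr 1; unfold minLen; ring
  have h2 : (ph : ℝ) ^ (2 * (m + 1)) ≤ (pv : ℝ) ^ (2 * (m + 1)) := pow_le_pow_left₀ hph.le hpv _
  have l1 := lam_nonneg ph
  have l2 := lam_nonneg pv
  rw [h1]
  calc lam ph ^ (2 * (n + 1)) * lam pv ^ (2 * (m + 1)) *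
        ((ph : ℝ) ^ (2 * (n + 1)) * (ph : ℝ) ^ (2 * (m + 1)) * (ph : ℝ) ^ minLen m n)
      ≤ lam ph ^ (2 * (n + 1)) * lam pv ^ (2 * (m + 1)) *
        ((ph : ℝ) ^ (2 * (n + 1)) * (pv : ℝ) ^ (2 * (m + 1)) * ∏ e ∈ O, openProb ph pv e) := by
        gcongr
    _ = _ := by ring

/-- The event that two vertices lie in the same finite open cluster. -/
def finiteConnEvent (x y : ℤ × ℤ) : Set Config :=
  {ω | ∃ A : lattice.Subgraph, IsOpenCluster ω A ∧ x ∈ A.verts ∧ y ∈ A.verts ∧ A.edgeSet.Finite}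

theorem lower_bound {ph pv : unitInterval} (hph : 0 < (ph : ℝ)) (hpv : (ph : ℝ) ≤ pv) (m n : ℕ) :
    (beta m n : ℝ) * lam ph ^ (2 * (n + 1)) * lam pv ^ (2 * (m + 1)) *
      (ph : ℝ) ^ (2 * minLen m n) ≤ truncConn ph pv (0, 0) ((m : ℤ), (n : ℤ)) := by
  have hfin := minContours_finite m n
  have hex := fun γ (hγ : γ ∈ minContours m n) => exists_inner_of_mem_minContours hγ
  choose! hH E hE hcard hconn using hex
  set ev : Set (Sym2 (ℤ × ℤ)) → Set Config := fun γ => cyl γ (E γ) with hev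
  have hreach : ∀ γ ∈ minContours m n, ∀ ω ∈ ev γ, ∀ s : State, s.Valid (interior γ) →
      (openGraph ω).Reachable (0, 0) s.1 := by
    intro γ hγ ω hω s hs
    refine hconn γ hγ _ ?_ s hs
    intro e he
    obtain ⟨u, w, rfl, huw, -⟩ := hE γ hγ e he
    exact ⟨huw, hω.2 ⟨s(u, w), huw⟩ he⟩
  have hin : ∀ γ ∈ minContours m n, ∀ ω ∈ ev γ, ∀ v, (openGraph ω).Reachable (0, 0) v →
      v ∈ interior γ := by
    intro γ hγ ω hω v hv
    refine cluster_subset (hγ.2.1 (Or.inl rfl)) ?_ hv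
    rw [edgeBoundary_interior hγ.1]
    exact hω.1
  have hdisj : Set.PairwiseDisjoint (hfin.toFinset : Set (Set (Sym2 (ℤ × ℤ)))) ev := by
    intro γ hγ γ' hγ' hne
    rw [Set.Finite.coe_toFinset] at hγ hγ'
    rw [Function.onFun, Set.disjoint_left]
    intro ω hω hω'
    apply hne
    -- The cluster of 0 lies inside `δ` and contains the inner boundary of `δ'`. By symmetry the two
    -- interiors coincide.
    have key : ∀ δ ∈ minContours m n, ∀ δ' ∈ minContours m n, ω ∈ ev δ → ω ∈ ev δ' →
        interior δ' ⊆ interior δ := by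
      intro δ hδ δ' hδ' h h'
      exact subset_of_inner_boundary (C := {v | (openGraph ω).Reachable (0, 0) v})
        (isRegion_interior hδ.1) (isRegion_interior hδ'.1) (hin δ hδ ω h) (hreach δ' hδ' ω h')
    rw [← edgeBoundary_interior hγ.1, ← edgeBoundary_interior hγ'.1,
      Set.Subset.antisymm (key γ' hγ' γ hγ hω' hω) (key γ hγ γ' hγ' hω hω')]
  have hsub : (⋃ γ ∈ hfin.toFinset, ev γ) ⊆ finiteConnEvent (0, 0) ((m : ℤ), (n : ℤ)) := by
    intro ω hω
    simp only [Set.mem_iUnion, Set.Finite.mem_toFinset] at hω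
    obtain ⟨γ, hγ, hω⟩ := hω
    have hV := isRegion_interior hγ.1
    refine ⟨cluster ω (0, 0), isOpenCluster_cluster ω _, SimpleGraph.Reachable.refl _, ?_,
      edgeSet_finite (hV.finite.subset (hin γ hγ ω hω))⟩
    obtain ⟨l, r, τ, hs, hp⟩ := exists_split_of_mem hγ
    have h1 := hs.le_period
    have h2 := hs.fst.hl
    have h3 := hs.fst.hr
    rw [hp] at h1
    obtain rfl : r = m := by omega
    -- For a minimal contour (m, n) is the rightmost point of its row, hence an inner boundary
    -- vertex, and so it is joined to 0.
    have := hreach γ hγ ω hω _ (trace_valid hs.valid τ)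
    rw [hs.trace_eq] at this
    exact this
  calc (beta m n : ℝ) * lam ph ^ (2 * (n + 1)) * lam pv ^ (2 * (m + 1)) *
        (ph : ℝ) ^ (2 * minLen m n)
      = ∑ _γ ∈ hfin.toFinset, lam ph ^ (2 * (n + 1)) * lam pv ^ (2 * (m + 1)) *
        (ph : ℝ) ^ (2 * minLen m n) := by
        rw [Finset.sum_const, nsmul_eq_mul, beta, Set.ncard_eq_toFinset_card _ hfin]; ring
    _ ≤ ∑ γ ∈ hfin.toFinset, (percMeasure ph pv).real (ev γ) := by
        refine Finset.sum_le_sum fun γ hγ => ?_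
        have hγ : γ ∈ minContours m n := by simpa using hγ
        exact prob_minContour_ge hph hpv hγ (hH γ hγ) (hE γ hγ) (hcard γ hγ)
    _ = (percMeasure ph pv).real (⋃ γ ∈ hfin.toFinset, ev γ) :=
        (measureReal_biUnion_finset hdisj fun γ _ => measurableSet_cyl _ _).symm
    _ ≤ _ := measureReal_mono hsub

/-! ### The upper bound -/

lemma finite_verts {ω : Config} {A : lattice.Subgraph} (hA : IsOpenCluster ω A)
    (hfin : A.edgeSet.Finite) {x : ℤ × ℤ} (hx : x ∈ A.verts) : A.verts.Finite := by
  have h1 : (⋃ e ∈ A.edgeSet, {v | v ∈ e}).Finite := by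
    refine hfin.biUnion fun e _ => ?_
    induction e using Sym2.ind with
    | _ u v => simp only [Sym2.mem_iff]; exact (Set.finite_singleton v).insert u
  refine (h1.insert x).subset fun v hv => ?_
  by_cases hxv : v = x
  · exact Or.inl hxv
  · right
    have hr : A.coe.Reachable ⟨v, hv⟩ ⟨x, hx⟩ := hA.1.coe.preconnected _ _
    rw [SimpleGraph.reachable_iff_reflTransGen] at hr
    rcases hr.cases_head with h | ⟨⟨w, hw⟩, hvw, -⟩
    · exact absurd (congrArg Subtype.val h) hxv
    · have hvw' : A.Adj v w := hvw
      simp only [Set.mem_iUnion]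
      exact ⟨s(v, w), hvw', Sym2.mem_mk_left v w⟩

/-- A finite open cluster containing `0` and `(m, n)` is surrounded by a closed contour. -/
lemma exists_closed_contour {m n : ℕ} {ω : Config}
    (h : ω ∈ finiteConnEvent (0, 0) ((m : ℤ), (n : ℤ))) :
    ∃ d, ∃ γ ∈ contoursAround (corners m n) (minLen m n + d), ω ∈ cyl γ ∅ := by
  obtain ⟨A, hA, h0, hx, hfin⟩ := h
  obtain ⟨V, hV, hAV, hb⟩ := exists_isRegion_of_connected (finite_verts hA hfin h0) ⟨_, h0⟩ (by
    intro u hu v hv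
    have hr : A.coe.Reachable ⟨u, hu⟩ ⟨v, hv⟩ := hA.1.coe.preconnected _ _
    let f : A.coe →g cutGraph A.verts :=
      ⟨Subtype.val, fun {a b} hab => cutGraph_adj.2 ⟨A.adj_sub hab, iff_of_true a.2 b.2⟩⟩
    exact hr.map f)
  obtain ⟨l, r, τ, hs⟩ := exists_split hV (hAV h0) (hAV hx)
  have h1 := hs.le_period
  have h2 := hs.fst.hl
  have h3 := hs.fst.hr
  refine ⟨period V ((l, 0), 3) - minLen m n, edgeBoundary V, ⟨isContour_edgeBoundary hV, ?_, ?_⟩, ?_⟩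
  · rw [interior_edgeBoundary hV]
    rintro v (rfl | rfl)
    · exact hAV h0
    · exact hAV hx
  · rw [ncard_edgeBoundary hV hs.valid]
    omega
  · exact ⟨fun e he => hA.2.2 e (hb he), fun e he => absurd he (Set.notMem_empty _)⟩

lemma lam_anti {p q : unitInterval} (hp : 0 < (p : ℝ)) (h : (p : ℝ) ≤ q) : lam q ≤ lam p :=
  div_le_div₀ (sub_nonneg.2 p.2.2) (by linarith) hp h

/-- The probability that a given contour is closed. -/
lemma prob_contour_le {ph pv : unitInterval} (hph : 0 < (ph : ℝ)) (hpv : (ph : ℝ) ≤ pv)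
    {m n d : ℕ} {γ : Set (Sym2 (ℤ × ℤ))} (hγ : γ ∈ contoursAround (corners m n) (minLen m n + d)) :
    (percMeasure ph pv).real (cyl γ ∅) ≤
      pv * (lam ph ^ (2 * (n + 1)) * lam pv ^ (2 * (m + 1))) * lam ph ^ d := by
  obtain ⟨C, hC⟩ := exists_finset_edges hγ.1.1 hγ.1.2.1
  obtain ⟨l, r, τ, hs, hp⟩ := exists_split_of_mem hγ
  have hV := isRegion_interior hγ.1
  have hcount := hs.le_count
  have hlen := Split.length_eq_count (Split.word (interior γ) l)
  rw [Split.length_word, hp] at hlen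
  have hhor := ncard_horizontal hV hs.valid
  rw [edgeBoundary_interior hγ.1] at hhor
  have hl := hs.fst.hl
  have hr := hs.fst.hr
  have hm : minLen m n = 2 * (n + 1) + 2 * (m + 1) := by unfold minLen; ring
  obtain ⟨a, ha⟩ : ∃ a, (γ ∩ {e | IsHorizontal e}).ncard = 2 * (n + 1) + a :=
    Nat.exists_eq_add_of_le (by omega)
  obtain ⟨b, hb'⟩ : ∃ b, γ.ncard = 2 * (n + 1) + a + 2 * (m + 1) + b := by
    refine Nat.exists_eq_add_of_le ?_
    rw [hγ.2.2]; omega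
  have hb : γ.ncard = 2 * (n + 1) + a + (2 * (m + 1) + b) := by rw [hb', add_assoc]
  have hd : d = a + b := by
    have := hγ.2.2
    omega
  have hmeas := measure_cyl_finset ph pv (Finset.disjoint_empty_right C)
  simp only [Finset.coe_empty, Set.image_empty, Finset.prod_empty, mul_one] at hmeas
  rw [← hC] at hmeas
  rw [hmeas, prod_one_sub_openProb ph pv C (a := 2 * (n + 1) + a) (b := 2 * (m + 1) + b)
    (by rw [← hC]; exact ha) (by rw [← hC]; exact hb)]
  have hpv0 : 0 < (pv : ℝ) := hph.trans_le hpv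
  rw [← lam_mul hph, ← lam_mul hpv0, mul_pow, mul_pow, hd]
  have l1 := lam_nonneg ph
  have l2 := lam_nonneg pv
  -- One factor p_v is kept instead of being bounded by 1; it makes the final inequality strict.
  have h1 : (ph : ℝ) ^ (2 * (n + 1) + a) ≤ pv :=
    (pow_le_of_le_one hph.le ph.2.2 (by omega)).trans hpv
  have h2 : (pv : ℝ) ^ (2 * (m + 1) + b) ≤ 1 := pow_le_one₀ hpv0.le pv.2.2
  have h3 : lam pv ^ b ≤ lam ph ^ b := pow_le_pow_left₀ l2 (lam_anti hph hpv) b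
  calc lam ph ^ (2 * (n + 1) + a) * (ph : ℝ) ^ (2 * (n + 1) + a) *
        (lam pv ^ (2 * (m + 1) + b) * (pv : ℝ) ^ (2 * (m + 1) + b))
      = (lam ph ^ (2 * (n + 1)) * lam pv ^ (2 * (m + 1))) * (lam ph ^ a * lam pv ^ b) *
        ((ph : ℝ) ^ (2 * (n + 1) + a) * (pv : ℝ) ^ (2 * (m + 1) + b)) := by
        rw [pow_add (lam ph), pow_add (lam pv)]; ring
    _ ≤ (lam ph ^ (2 * (n + 1)) * lam pv ^ (2 * (m + 1))) * (lam ph ^ a * lam ph ^ b) *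
        (pv * 1) := by gcongr
    _ = _ := by rw [pow_add (lam ph) a b]; ring

/-- The bound on the number of contours, divided into its two regimes. -/
noncomputable def contourBound (B N d : ℕ) : ℝ :=
  if d ≤ N / 2 then B * (N.choose d * 12 ^ d) else 64 ^ d

/-- For d > ‖x‖/2 one has ‖x‖ + d ≤ 3d, so the crude bound is at most 4^(3d) = 64^d. -/
lemma ncard_contoursAround_le {m n : ℕ} (d : ℕ) :
    ((contoursAround (corners m n) (minLen m n + d)).ncard : ℝ) ≤
      contourBound (beta n m) (minLen m n) d := by
  unfold contourBound
  split_ifs with h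
  · exact_mod_cast ncard_contoursAround_le_beta (m := m) (n := n) (d := d) (by omega)
  · have h1 := ncard_contoursAround_le_pow m n d
    have h2 : 4 ^ (minLen m n + d) ≤ 64 ^ d := by
      rw [show (64 : ℕ) = 4 ^ 3 from rfl, ← pow_mul]
      exact Nat.pow_le_pow_right (by norm_num) (by omega)
    exact_mod_cast h1.trans h2

/-- The terms beyond `N / 2` form a geometric series with ratio 64x; the earlier ones are completed
to the full binomial expansion. -/
lemma hasSum_contourBound_le {x : ℝ} (h0 : 0 ≤ x) (h1 : 64 * x < 1) (B N : ℕ) :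
    Summable (fun d => contourBound B N d * x ^ d) ∧
    ∑' d, contourBound B N d * x ^ d ≤
      (64 * x) ^ (N / 2 + 1) / (1 - 64 * x) + B * (1 + 12 * x) ^ N := by
  have htail : ∀ d, contourBound B N (d + (N / 2 + 1)) * x ^ (d + (N / 2 + 1)) =
      (64 * x) ^ (N / 2 + 1) * (64 * x) ^ d := by
    intro d
    unfold contourBound
    rw [if_neg (by omega), ← mul_pow, ← pow_add, add_comm]
  have hgeo := (hasSum_geometric_of_lt_one (by positivity : 0 ≤ 64 * x) h1).mul_left
    ((64 * x) ^ (N / 2 + 1))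
  have hs : Summable (fun d => contourBound B N d * x ^ d) := by
    rw [← summable_nat_add_iff (N / 2 + 1)]
    simp_rw [htail]
    exact hgeo.summable
  refine ⟨hs, ?_⟩
  rw [← hs.sum_add_tsum_nat_add (N / 2 + 1)]
  simp_rw [htail]
  rw [hgeo.tsum_eq, add_comm]
  refine add_le_add (le_of_eq (by rw [div_eq_mul_inv])) ?_
  calc ∑ d ∈ Finset.range (N / 2 + 1), contourBound B N d * x ^ d
      = ∑ d ∈ Finset.range (N / 2 + 1), B * ((12 * x) ^ d * N.choose d) := by
        refine Finset.sum_congr rfl fun d hd => ?_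
        unfold contourBound
        rw [if_pos (by have := Finset.mem_range.1 hd; omega), mul_pow]
        ring
    _ ≤ ∑ d ∈ Finset.range (N + 1), B * ((12 * x) ^ d * N.choose d) := by
        refine Finset.sum_le_sum_of_subset_of_nonneg
          (Finset.range_subset_range.2 (by omega)) fun d _ _ => by positivity
    _ = B * (1 + 12 * x) ^ N := by
        rw [← Finset.mul_sum, add_comm 1, add_pow]
        simp

theorem upper_bound {ph pv : unitInterval} (hph : 0 < (ph : ℝ)) (hpv : (ph : ℝ) ≤ pv)
    (hpv1 : (pv : ℝ) < 1) (hlam : 64 * lam ph < 1) (m n : ℕ) :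
    truncConn ph pv (0, 0) ((m : ℤ), (n : ℤ)) <
      lam ph ^ (2 * (n + 1)) * lam pv ^ (2 * (m + 1)) *
        ((64 * lam ph) ^ (minLen m n / 2 + 1) / (1 - 64 * lam ph) +
          (beta n m : ℝ) * (1 + 12 * lam ph) ^ minLen m n) := by
  have hpv0 : 0 < (pv : ℝ) := hph.trans_le hpv
  have l1 : 0 < lam ph := div_pos (by linarith) hph
  have l2 : 0 < lam pv := div_pos (by linarith) hpv0
  set N := minLen m n with hN
  set K := lam ph ^ (2 * (n + 1)) * lam pv ^ (2 * (m + 1)) with hK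
  have hKpos : 0 < K := by positivity
  set R := (64 * lam ph) ^ (N / 2 + 1) / (1 - 64 * lam ph) +
          (beta n m : ℝ) * (1 + 12 * lam ph) ^ N with hR
  have hRpos : 0 < R := by
    have : 0 < 1 - 64 * lam ph := by linarith
    positivity
  obtain ⟨hsum, hle⟩ := hasSum_contourBound_le l1.le hlam (beta n m) N
  set c : ℕ → ℝ := fun d => pv * K * (contourBound (beta n m) N d * lam ph ^ d) with hc
  have hcnn : ∀ d, 0 ≤ c d := by
    intro d
    have : 0 ≤ contourBound (beta n m) N d := (Nat.cast_nonneg _).trans (ncard_contoursAround_le d)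
    positivity
  have hcs : Summable c := hsum.mul_left _
  have hmeas : percMeasure ph pv (finiteConnEvent (0, 0) ((m : ℤ), (n : ℤ))) ≤
      ENNReal.ofReal (∑' d, c d) := by
    have hsub : finiteConnEvent (0, 0) ((m : ℤ), (n : ℤ)) ⊆
        ⋃ d, ⋃ γ ∈ (contoursAround_finite m n d).toFinset, cyl γ ∅ := by
      intro ω hω
      obtain ⟨d, γ, hγ, h⟩ := exists_closed_contour hω
      simp only [Set.mem_iUnion, Set.Finite.mem_toFinset]
      exact ⟨d, γ, hγ, h⟩
    refine (measure_mono hsub).trans ((measure_iUnion_le _).trans ?_)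
    rw [ENNReal.ofReal_tsum_of_nonneg hcnn hcs]
    refine ENNReal.tsum_le_tsum fun d => ?_
    rw [← ofReal_measureReal (measure_ne_top _ _)]
    refine ENNReal.ofReal_le_ofReal ((measureReal_biUnion_finset_le _ _).trans ?_)
    calc ∑ γ ∈ (contoursAround_finite m n d).toFinset, (percMeasure ph pv).real (cyl γ ∅)
        ≤ ∑ _γ ∈ (contoursAround_finite m n d).toFinset, pv * K * lam ph ^ d :=
          Finset.sum_le_sum fun γ hγ => prob_contour_le hph hpv (by simpa using hγ)
      _ = (contoursAround (corners m n) (N + d)).ncard * (pv * K * lam ph ^ d) := by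
          rw [Finset.sum_const, nsmul_eq_mul, Set.ncard_eq_toFinset_card _ (contoursAround_finite m n d)]
      _ ≤ contourBound (beta n m) N d * (pv * K * lam ph ^ d) := by
          gcongr
          exact ncard_contoursAround_le d
      _ = c d := by rw [hc]; ring
  have h1 : truncConn ph pv (0, 0) ((m : ℤ), (n : ℤ)) ≤ ∑' d, c d :=
    ENNReal.toReal_le_of_le_ofReal (tsum_nonneg hcnn) hmeas
  calc truncConn ph pv (0, 0) ((m : ℤ), (n : ℤ)) ≤ ∑' d, c d := h1
    _ = pv * K * ∑' d, contourBound (beta n m) N d * lam ph ^ d := tsum_mul_left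
    _ ≤ pv * K * R := by gcongr
    _ = pv * (K * R) := by ring
    -- Here p_v < 1 is used together with `K * R > 0`.
    _ < 1 * (K * R) := by gcongr
    _ = K * R := one_mul _

end AnisoPerc

theorem mainTheorem2 (ph pv : unitInterval) (hph : 0 < (ph : ℝ)) (hpv : (ph : ℝ) ≤ (pv : ℝ))
    (x₁ x₂ : ℕ) (hx₁ : 0 < x₁) (hx₂ : 0 < x₂) :
    (AnisoPerc.minContours x₁ x₂).Finite ∧
    (AnisoPerc.beta x₁ x₂ : ℝ) * AnisoPerc.lam ph ^ (2 * (x₂ + 1)) *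
        AnisoPerc.lam pv ^ (2 * (x₁ + 1)) * (ph : ℝ) ^ (2 * AnisoPerc.minLen x₁ x₂)
      ≤ AnisoPerc.truncConn ph pv (0, 0) ((x₁ : ℤ), (x₂ : ℤ)) ∧
    ((pv : ℝ) < 1 → AnisoPerc.lam ph < 1 / 4 ^ 3 →
      AnisoPerc.truncConn ph pv (0, 0) ((x₂ : ℤ), (x₁ : ℤ)) <
        AnisoPerc.lam ph ^ (2 * (x₁ + 1)) * AnisoPerc.lam pv ^ (2 * (x₂ + 1)) *
          ((64 * AnisoPerc.lam ph) ^ (AnisoPerc.minLen x₁ x₂ / 2 + 1) /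
              (1 - 64 * AnisoPerc.lam ph) +
            (AnisoPerc.beta x₁ x₂ : ℝ) *
              (1 + 12 * AnisoPerc.lam ph) ^ AnisoPerc.minLen x₁ x₂)) := by
  refine ⟨AnisoPerc.minContours_finite x₁ x₂, AnisoPerc.lower_bound hph hpv x₁ x₂,
    fun hpv1 hlam => ?_⟩
  -- The target is x', and `upper_bound` counts by `beta` with exchanged arguments, so β_x appears
  -- without a separate symmetry argument.
  have h := AnisoPerc.upper_bound hph hpv hpv1 (by norm_num at hlam; linarith) x₂ x₁
  have hlen : AnisoPerc.minLen x₂ x₁ = AnisoPerc.minLen x₁ x₂ := by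
    unfold AnisoPerc.minLen; ring
  rwa [hlen] at h
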